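/- Let $\Phi=(V,R,V^\vee,R^\vee)$ be a reduced real root system: $V,V^\vee$ are finite-dimensional real vector spaces in perfect pairing $(\ ,\ )$; $R$ and $R^\vee$ are finite sets in bijection $\alpha\leftrightarrow\alpha^\vee$ with $(\alpha,\alpha^\vee)=2$, preserved by the reflections $s_\alpha$ (neither crystallographic nor spanning is assumed); the only roots proportional to $\alpha$ are $\pm\alpha$. Let $W\subset GL(V)$ be generated by the $s_\alpha$, let $\Pi\subset R$ be a set of simple roots, and let $k:\Pi\to\mathbb R\setminus\{0\}$ be such that $k_\alpha=k_{\alpha'}$ whenever $\alpha,\alpha'\in\Pi$ are $W$-conjugate. Let $\mathbb H$ be the associated graded affine Hecke algebra: the unital associative $\mathbb C$-algebra generated by $\mathbb A=S(V_{\mathbb C})$ and $t_w$ ($w\in W$), where $w\mapsto t_w$ is multiplicative, $\mathbb A\to\mathbb H$ is an algebra homomorphism, and $$a\,t_{s_\alpha}=t_{s_\alpha}s_\alpha(a)+k_\alpha\,\frac{a-s_\alpha(a)}{\alpha}\qquad(\alpha\in\Pi,\ a\in\mathbb A).$$ Let $\bullet$ be the conjugate-linear anti-automorphism of $\mathbb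 H$ with $t_w^\bullet=t_{w^{-1}}$ for $w\in W$ and $\omega^\bullet=\overline\omega$ for $\omega\in V_{\mathbb C}$. A hermitian form $\langle\ ,\ \rangle$ on an $\mathbb H$-module $X$ is $\bullet$-invariant if $\langle hx,y\rangle=\langle x,h^\bullet y\rangle$ for all $h\in\mathbb H$, $x,y\in X$. Let $\Omega(X)\subset V^\vee_{\mathbb C}$ be the set of $\mathbb A$-weights of $X$, i.e. of those $\lambda$ for which there is a nonzero $x\in X$ such that for every $a\in\mathbb A$ some power of $a-(a,\lambda)$ kills $x$; here $(a,\lambda)$ is the value at $\lambda$ of $a$, viewed as a polynomial function on $V^\vee_{\mathbb C}$. Let $X$ be an irreducible $\mathbb H$-module. Then $X$ admits a nondegenerate $\bullet$-invariant hermitian form if and only if $\overline{\Omega(X)}=\Omega(X)$. In particular, if $X$ has real central character, i.e. if there is $\lambda\in V^\vee$ such that every $a\in S(V_{\mathbb C})^W$ acts on $X$ by the scalar $(a,\lambda)$, then $X$ admits a nondegenerate $\bullet$-invariant hermitian form. -/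

import Mathlib

open scoped TensorProduct ComplexConjugate NNReal

namespace GradedHecke

noncomputable section

/-! ### Complexification and complex conjugation -/

/-- The complexification `V_ℂ = ℂ ⊗ V` of a real vector space. -/
abbrev Cx (V : Type*) [AddCommGroup V] [Module ℝ V] : Type _ := ℂ ⊗[ℝ] V

/-- Complex conjugation of `V_ℂ` with respect to the real form `V`: `z ⊗ v ↦ conj z ⊗ v`. -/
def conjCx (V : Type*) [AddCommGroup V] [Module ℝ V] : Cx V →ₗ[ℝ] Cx V :=
  LinearMap.rTensor V Complex.conjAe.toLinearMap

/-- A complex algebra `A` with the conjugate scalar action `z • a = conj z * a`. It is used only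
to produce conjugate linear ring homomorphisms out of universal properties. -/
def ConjAlg (A : Type*) : Type _ := A

instance {A : Type*} [Ring A] : Ring (ConjAlg A) := inferInstanceAs (Ring A)

instance {A : Type*} [CommRing A] : CommRing (ConjAlg A) := inferInstanceAs (CommRing A)

instance {A : Type*} [Ring A] [Algebra ℂ A] : Algebra ℂ (ConjAlg A) :=
  RingHom.toAlgebra' (((algebraMap ℂ A).comp (starRingEnd ℂ) : ℂ →+* A) : ℂ →+* ConjAlg A)
    (fun c x => Algebra.commutes (A := A) (conj c) x)

/-- The identity map, as a ring isomorphism `ConjAlg A ≃ A`. -/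
def ConjAlg.toBase (A : Type*) [Ring A] : ConjAlg A ≃+* A := RingEquiv.refl A

lemma ConjAlg.toBase_algebraMap {A : Type*} [Ring A] [Algebra ℂ A] (z : ℂ) :
    ConjAlg.toBase A (algebraMap ℂ (ConjAlg A) z) = algebraMap ℂ A (conj z) := rfl

lemma ConjAlg.toBase_smul {A : Type*} [Ring A] [Algebra ℂ A] (z : ℂ) (a : ConjAlg A) :
    ConjAlg.toBase A (z • a) = conj z • ConjAlg.toBase A a := by
  rw [Algebra.smul_def, map_mul, ConjAlg.toBase_algebraMap, Algebra.smul_def]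

section SymmetricAlgebra

variable {V : Type*} [AddCommGroup V] [Module ℝ V]

variable (V) in
/-- The symmetric algebra `𝔸 = S(V_ℂ)`. -/
abbrev SymAlg : Type _ := SymmetricAlgebra ℂ (Cx V)

/-- A vector `v ∈ V` as an element of `S(V_ℂ)`. -/
def ofReal (v : V) : SymAlg V := SymmetricAlgebra.ι ℂ (Cx V) (1 ⊗ₜ v)

lemma ι_tmul (z : ℂ) (v : V) : SymmetricAlgebra.ι ℂ (Cx V) (z ⊗ₜ v) = z • ofReal v := by
  rw [ofReal, ← map_smul, TensorProduct.smul_tmul', smul_eq_mul, mul_one]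

/-- Two ring homomorphisms out of `S(V_ℂ)` agree if they agree on scalars and on `V`. -/
lemma sym_ringHom_ext {B : Type*} [Semiring B] {f g : SymAlg V →+* B}
    (h₁ : ∀ z : ℂ, f (algebraMap ℂ _ z) = g (algebraMap ℂ _ z))
    (h₂ : ∀ v : V, f (ofReal v) = g (ofReal v)) : f = g := by
  refine RingHom.ext fun a => ?_
  induction a using SymmetricAlgebra.induction with
  | algebraMap r => exact h₁ r
  | ι x =>
    induction x using TensorProduct.induction_on with
    | zero => simp
    | tmul z v => rw [ι_tmul, Algebra.smul_def, map_mul, map_mul, h₁, h₂]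
    | add x y hx hy => rw [map_add, map_add, map_add, hx, hy]
  | mul a b ha hb => rw [map_mul, map_mul, ha, hb]
  | add a b ha hb => rw [map_add, map_add, ha, hb]

/-- The action on `S(V_ℂ)` of a linear automorphism of `V`, by algebra automorphisms. -/
def act (g : V ≃ₗ[ℝ] V) : SymAlg V →ₐ[ℂ] SymAlg V :=
  SymmetricAlgebra.lift (SymmetricAlgebra.ι ℂ (Cx V) ∘ₗ (g : V →ₗ[ℝ] V).baseChange ℂ)

@[simp] lemma act_ofReal (g : V ≃ₗ[ℝ] V) (v : V) : act g (ofReal v) = ofReal (g v) := by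
  simp [act, ofReal]

/-- Conjugate linear ring homomorphism `S(V_ℂ) → S(V_ℂ)` induced by conjugation on `V_ℂ`. -/
def conjSym : SymAlg V →+* SymAlg V :=
  (ConjAlg.toBase (SymAlg V) : ConjAlg (SymAlg V) →+* SymAlg V).comp
    (SymmetricAlgebra.lift (A := ConjAlg (SymAlg V))
      (LinearMap.liftBaseChange ℂ
        { toFun := fun v => ((ConjAlg.toBase (SymAlg V)).symm (ofReal v))
          map_add' := fun v w => by simp [ofReal, TensorProduct.tmul_add]
          map_smul' := fun r v => by
            apply (ConjAlg.toBase (SymAlg V)).injective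
            have h : (ofReal (r • v) : SymAlg V) = (r : ℂ) • ofReal v := by
              rw [← ι_tmul, ofReal, TensorProduct.tmul_smul, TensorProduct.smul_tmul']
              simp
            rw [RingEquiv.apply_symm_apply, h, RingHom.id_apply, ← Complex.coe_smul,
              ConjAlg.toBase_smul, Complex.conj_ofReal, RingEquiv.apply_symm_apply] }) :
      SymAlg V →ₐ[ℂ] ConjAlg (SymAlg V)).toRingHom

@[simp] lemma conjSym_algebraMap (z : ℂ) :
    conjSym (algebraMap ℂ (SymAlg V) z) = algebraMap ℂ (SymAlg V) (conj z) := by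
  simp [conjSym, ConjAlg.toBase_algebraMap]

@[simp] lemma conjSym_ofReal (v : V) : conjSym (ofReal v) = ofReal v := by
  simp only [conjSym, RingHom.comp_apply]
  rw [ofReal]
  simp [ofReal]

lemma conjSym_smul (z : ℂ) (a : SymAlg V) : conjSym (z • a) = conj z • conjSym a := by
  rw [Algebra.smul_def, map_mul, conjSym_algebraMap, Algebra.smul_def]

/-- On `V_ℂ ⊆ S(V_ℂ)` the map `conjSym` is the complex conjugation of `V_ℂ`. -/
lemma conjSym_ι (x : Cx V) :
    conjSym (SymmetricAlgebra.ι ℂ (Cx V) x) = SymmetricAlgebra.ι ℂ (Cx V) (conjCx V x) := by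
  induction x using TensorProduct.induction_on with
  | zero => simp
  | tmul z v =>
    rw [ι_tmul, conjSym_smul, conjSym_ofReal]
    simp [conjCx, ι_tmul]
  | add x y hx hy => simp only [map_add, hx, hy]

@[simp] lemma conjSym_conjSym (a : SymAlg V) : conjSym (conjSym a) = a := by
  have : (conjSym (V := V)).comp conjSym = RingHom.id _ :=
    sym_ringHom_ext (by simp) (by simp)
  exact congrArg (fun f : SymAlg V →+* SymAlg V => f a) this

lemma conjSym_act (g : V ≃ₗ[ℝ] V) (a : SymAlg V) : conjSym (act g a) = act g (conjSym a) := by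
  have : (conjSym (V := V)).comp (act g).toRingHom = (act g).toRingHom.comp conjSym :=
    sym_ringHom_ext (by simp) (by simp)
  exact congrArg (fun f : SymAlg V →+* SymAlg V => f a) this

lemma act_act (g h : V ≃ₗ[ℝ] V) (a : SymAlg V) : act g (act h a) = act (g * h) a := by
  have : (act g).toRingHom.comp (act h).toRingHom = (act (g * h)).toRingHom :=
    sym_ringHom_ext (by simp) (by simp)
  exact congrArg (fun f : SymAlg V →+* SymAlg V => f a) this

lemma act_one (a : SymAlg V) : act 1 a = a := by
  have : (act (1 : V ≃ₗ[ℝ] V)).toRingHom = RingHom.id (SymAlg V) :=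
    sym_ringHom_ext (by simp) (by simp)
  exact congrArg (fun f : SymAlg V →+* SymAlg V => f a) this

end SymmetricAlgebra

section Root

variable {I V V' : Type*} [AddCommGroup V] [Module ℝ V] [AddCommGroup V'] [Module ℝ V']

/-- The complex bilinear extension `V_ℂ × V'_ℂ → ℂ` of the pairing `V × V' → ℝ`. -/
def pairC (P : RootPairing I ℝ V V') : Cx V →ₗ[ℂ] Cx V' →ₗ[ℂ] ℂ :=
  LinearMap.liftBaseChange ℂ
    ((LinearMap.liftBaseChangeEquiv ℂ).toLinearMap.restrictScalars ℝ ∘ₗ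
      LinearMap.compRight ℝ (Complex.ofRealCLM : ℝ →ₗ[ℝ] ℂ) ∘ₗ P.toLinearMap)

lemma pairC_tmul (P : RootPairing I ℝ V V') (z w : ℂ) (v : V) (u : V') :
    pairC P (z ⊗ₜ v) (w ⊗ₜ u) = z * w * (P.toLinearMap v u : ℂ) := by
  simp [pairC, mul_assoc]

/-- `(a, μ)`: evaluation of `a ∈ S(V_ℂ)`, a polynomial function on `V'_ℂ`, at `μ ∈ V'_ℂ`. -/
def ev (P : RootPairing I ℝ V V') (μ : Cx V') : SymAlg V →ₐ[ℂ] ℂ :=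
  SymmetricAlgebra.lift ((pairC P).flip μ)

@[simp] lemma ev_ofReal (P : RootPairing I ℝ V V') (v : V) (u : V') :
    ev P (1 ⊗ₜ u) (ofReal v) = (P.toLinearMap v u : ℂ) := by
  simp [ev, ofReal, pairC_tmul]

/-- The Weyl group `W ⊆ GL(V)`, generated by the reflections `s_α`. -/
abbrev W (P : RootPairing I ℝ V V') : Subgroup (V ≃ₗ[ℝ] V) :=
  Subgroup.closure (Set.range P.reflection)

/-- The reflection `s_α` as an element of `W`. -/
def weylRefl (P : RootPairing I ℝ V V') (i : I) : W P :=
  ⟨P.reflection i, Subgroup.subset_closure ⟨i, rfl⟩⟩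

/-- A set of simple roots, given by their indices: the roots in it are linearly independent, and
every root is, up to sign, a combination of them with nonnegative real coefficients. -/
structure SimpleRoots (P : RootPairing I ℝ V V') where
  carrier : Set I
  linearIndepOn : LinearIndepOn ℝ P.root carrier
  pos_or_neg : ∀ i, P.root i ∈ Submodule.span ℝ≥0 (P.root '' carrier) ∨
    -P.root i ∈ Submodule.span ℝ≥0 (P.root '' carrier)

lemma weylRefl_mul_self (P : RootPairing I ℝ V V') (i : I) : weylRefl P i * weylRefl P i = 1 := by
  ext v
  simp [weylRefl]

lemma root_ne_zero (P : RootPairing I ℝ V V') (i : I) : ofReal (P.root i) ≠ 0 := by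
  intro h
  have := ev_ofReal P (P.root i) (P.coroot i)
  rw [h, map_zero, P.root_coroot_two] at this
  norm_num at this

lemma root_dvd (P : RootPairing I ℝ V V') (i : I) (a : SymAlg V) :
    ofReal (P.root i) ∣ a - act (P.reflection i) a := by
  rw [← Ideal.mem_span_singleton, ← Ideal.Quotient.eq]
  have : Ideal.Quotient.mk (Ideal.span {ofReal (P.root i)}) =
      (Ideal.Quotient.mk (Ideal.span {ofReal (P.root i)})).comp
        (act (P.reflection i)).toRingHom := by
    apply sym_ringHom_ext
    · simp
    · intro v
      simp only [AlgHom.toRingHom_eq_coe, RingHom.comp_apply, RingHom.coe_coe, act_ofReal]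
      rw [Ideal.Quotient.eq, Ideal.mem_span_singleton]
      refine ⟨algebraMap ℂ _ (P.toLinearMap v (P.coroot i) : ℂ), ?_⟩
      rw [mul_comm, ← Algebra.smul_def, ← ι_tmul, ofReal, ofReal, ← map_sub,
        ← TensorProduct.tmul_sub, RootPairing.reflection_apply, sub_sub_cancel,
        TensorProduct.tmul_smul, TensorProduct.smul_tmul']
      simp
  exact congrArg (fun f : SymAlg V →+* _ => f a) this

/-- The difference operator `Δ_α(a) = (a - s_α(a)) / α` on `S(V_ℂ)`. -/
def diffOp (P : RootPairing I ℝ V V') (i : I) (a : SymAlg V) : SymAlg V :=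
  (root_dvd P i a).choose

lemma root_mul_diffOp (P : RootPairing I ℝ V V') (i : I) (a : SymAlg V) :
    ofReal (P.root i) * diffOp P i a = a - act (P.reflection i) a :=
  (root_dvd P i a).choose_spec.symm

lemma diffOp_unique (P : RootPairing I ℝ V V') (i : I) {a b : SymAlg V}
    (h : ofReal (P.root i) * b = a - act (P.reflection i) a) : diffOp P i a = b :=
  mul_left_cancel₀ (root_ne_zero P i) ((root_mul_diffOp P i a).trans h.symm)

lemma conjSym_diffOp (P : RootPairing I ℝ V V') (i : I) (a : SymAlg V) :
    conjSym (diffOp P i a) = diffOp P i (conjSym a) := by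
  refine (diffOp_unique P i ?_).symm
  rw [← conjSym_act, ← map_sub, ← root_mul_diffOp, map_mul, conjSym_ofReal]

lemma act_reflection_reflection (P : RootPairing I ℝ V V') (i : I) (a : SymAlg V) :
    act (P.reflection i) (act (P.reflection i) a) = a := by
  have h : P.reflection i * P.reflection i = 1 := by ext v; simp
  rw [act_act, h, act_one]

lemma diffOp_act (P : RootPairing I ℝ V V') (i : I) (a : SymAlg V) :
    diffOp P i (act (P.reflection i) a) = -diffOp P i a := by
  refine diffOp_unique P i ?_
  rw [act_reflection_reflection, mul_neg, root_mul_diffOp, neg_sub]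

/-! ### The graded affine Hecke algebra -/

variable {P : RootPairing I ℝ V V'}

/-- The free algebra on symbols `t_w`, `w ∈ W`, and `a ∈ S(V_ℂ)`. -/
abbrev FreeAlg (P : RootPairing I ℝ V V') : Type _ := FreeAlgebra ℂ (W P ⊕ SymAlg V)

/-- The symbol `t_w`. -/
abbrev symT (w : W P) : FreeAlg P := FreeAlgebra.ι ℂ (Sum.inl w)

variable (P) in
/-- The symbol `a`. -/
abbrev symA (a : SymAlg V) : FreeAlg P := FreeAlgebra.ι ℂ (Sum.inr a)

/-- The defining relations: `w ↦ t_w` is multiplicative, `S(V_ℂ)` embeds by an algebra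
homomorphism, and `a t_{s_α} = t_{s_α} s_α(a) + k_α Δ_α(a)` for `α` simple. -/
inductive Rel (Δ : SimpleRoots P) (k : Δ.carrier → ℝ) : FreeAlg P → FreeAlg P → Prop
  | t_one : Rel Δ k (symT 1) 1
  | t_mul (w w' : W P) : Rel Δ k (symT (w * w')) (symT w * symT w')
  | a_scalar (z : ℂ) : Rel Δ k (symA P (algebraMap ℂ (SymAlg V) z)) (algebraMap ℂ (FreeAlg P) z)
  | a_add (a b : SymAlg V) : Rel Δ k (symA P (a + b)) (symA P a + symA P b)
  | a_mul (a b : SymAlg V) : Rel Δ k (symA P (a * b)) (symA P a * symA P b)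
  | cross (i : Δ.carrier) (a : SymAlg V) :
      Rel Δ k (symA P a * symT (weylRefl P i))
        (symT (weylRefl P i) * symA P (act (P.reflection i) a) +
          algebraMap ℂ (FreeAlg P) (k i : ℂ) * symA P (diffOp P i a))

/-- The graded affine Hecke algebra `ℍ(Φ, k)`, by generators and relations. -/
def Hecke (Δ : SimpleRoots P) (k : Δ.carrier → ℝ) : Type _ := RingQuot (Rel Δ k)

variable (Δ : SimpleRoots P) (k : Δ.carrier → ℝ)

instance : Ring (Hecke Δ k) := inferInstanceAs (Ring (RingQuot (Rel Δ k)))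

instance : Algebra ℂ (Hecke Δ k) := inferInstanceAs (Algebra ℂ (RingQuot (Rel Δ k)))

/-- The quotient map from the free algebra. -/
def mk : FreeAlg P →ₐ[ℂ] Hecke Δ k := RingQuot.mkAlgHom ℂ (Rel Δ k)

variable {Δ k} in
lemma mk_rel {x y : FreeAlg P} (h : Rel Δ k x y) : mk Δ k x = mk Δ k y :=
  RingQuot.mkAlgHom_rel ℂ h

/-- The elements `t_w` of `ℍ`. -/
def t : W P →* Hecke Δ k where
  toFun w := mk Δ k (symT w)
  map_one' := (mk_rel .t_one).trans (map_one _)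
  map_mul' w w' := (mk_rel (.t_mul w w')).trans (map_mul _ _ _)

/-- The map `S(V_ℂ) → ℍ`. -/
def incl : SymAlg V →ₐ[ℂ] Hecke Δ k where
  toFun a := mk Δ k (symA P a)
  map_one' := by
    have h := mk_rel (Rel.a_scalar (Δ := Δ) (k := k) 1)
    rwa [map_one, map_one, map_one] at h
  map_mul' a b := (mk_rel (.a_mul a b)).trans (map_mul _ _ _)
  map_zero' := by
    have h := mk_rel (Rel.a_scalar (Δ := Δ) (k := k) 0)
    rwa [map_zero, map_zero, map_zero] at h
  map_add' a b := (mk_rel (.a_add a b)).trans (map_add _ _ _)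
  commutes' z := (mk_rel (.a_scalar z)).trans (AlgHom.commutes _ _)

lemma incl_mul_t (i : Δ.carrier) (a : SymAlg V) :
    incl Δ k a * t Δ k (weylRefl P i) =
      t Δ k (weylRefl P i) * incl Δ k (act (P.reflection i) a) + (k i : ℂ) • incl Δ k (diffOp P i a) := by
  have h := mk_rel (Rel.cross (Δ := Δ) (k := k) i a)
  rwa [map_mul, map_add, map_mul, map_mul, AlgHom.commutes, ← Algebra.smul_def] at h

/-- A ring homomorphism out of `ℍ` is determined by its values on scalars, `t_w` and `S(V_ℂ)`. -/
lemma hecke_ringHom_ext {B : Type*} [Semiring B] {f g : Hecke Δ k →+* B}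
    (h₁ : ∀ z : ℂ, f (algebraMap ℂ _ z) = g (algebraMap ℂ _ z))
    (h₂ : ∀ w, f (t Δ k w) = g (t Δ k w)) (h₃ : ∀ a, f (incl Δ k a) = g (incl Δ k a)) :
    f = g := by
  refine RingHom.ext fun h => ?_
  obtain ⟨x, rfl⟩ : ∃ x, mk Δ k x = h := RingQuot.mkAlgHom_surjective ℂ (Rel Δ k) h
  induction x using FreeAlgebra.induction with
  | grade0 z => rw [AlgHom.commutes]; exact h₁ z
  | grade1 x =>
    rcases x with w | a
    · exact h₂ w
    · exact h₃ a
  | mul x y hx hy => rw [map_mul, map_mul, map_mul, hx, hy]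
  | add x y hx hy => rw [map_add, map_add, map_add, hx, hy]

/-! ### The star operation `•` -/

/-- `•` on the free algebra. -/
def bulletFree : FreeAlg P →+* (Hecke Δ k)ᵐᵒᵖ :=
  (ConjAlg.toBase (Hecke Δ k)ᵐᵒᵖ : ConjAlg (Hecke Δ k)ᵐᵒᵖ →+* (Hecke Δ k)ᵐᵒᵖ).comp
    (FreeAlgebra.lift ℂ (A := ConjAlg (Hecke Δ k)ᵐᵒᵖ)
      (fun x => (ConjAlg.toBase (Hecke Δ k)ᵐᵒᵖ).symm (x.elim
        (fun w => MulOpposite.op (t Δ k w⁻¹))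
        (fun a => MulOpposite.op (incl Δ k (conjSym a)))))).toRingHom

lemma bulletFree_symT (w : W P) :
    bulletFree Δ k (symT w) = MulOpposite.op (t Δ k w⁻¹) := by
  simp [bulletFree]

lemma bulletFree_symA (a : SymAlg V) :
    bulletFree Δ k (symA P a) = MulOpposite.op (incl Δ k (conjSym a)) := by
  simp [bulletFree]

lemma bulletFree_algebraMap (z : ℂ) :
    bulletFree Δ k (algebraMap ℂ (FreeAlg P) z) = algebraMap ℂ (Hecke Δ k)ᵐᵒᵖ (conj z) := by
  simp only [bulletFree, RingHom.comp_apply, AlgHom.toRingHom_eq_coe, RingHom.coe_coe,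
    AlgHom.commutes]
  exact ConjAlg.toBase_algebraMap z

lemma bulletFree_rel {x y : FreeAlg P} (h : Rel Δ k x y) :
    bulletFree Δ k x = bulletFree Δ k y := by
  induction h with
  | t_one => rw [bulletFree_symT, inv_one, map_one, map_one, MulOpposite.op_one]
  | t_mul w w' =>
    rw [map_mul, bulletFree_symT, bulletFree_symT, bulletFree_symT, mul_inv_rev, map_mul,
      MulOpposite.op_mul]
  | a_scalar z =>
    rw [bulletFree_symA, bulletFree_algebraMap, conjSym_algebraMap, AlgHom.commutes,
      MulOpposite.algebraMap_apply]
  | a_add a b =>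
    rw [map_add, bulletFree_symA, bulletFree_symA, bulletFree_symA, map_add, map_add,
      MulOpposite.op_add]
  | a_mul a b =>
    rw [map_mul, bulletFree_symA, bulletFree_symA, bulletFree_symA, ← MulOpposite.op_mul,
      ← map_mul, ← map_mul, mul_comm]
  | cross i a =>
    have hinv : (weylRefl P (i : I))⁻¹ = weylRefl P i := inv_eq_of_mul_eq_one_left (weylRefl_mul_self P i)
    rw [map_add, map_mul, map_mul, map_mul, bulletFree_symA, bulletFree_symA, bulletFree_symA,
      bulletFree_symT, bulletFree_algebraMap, hinv, Complex.conj_ofReal,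
      MulOpposite.algebraMap_apply, ← MulOpposite.op_mul, ← MulOpposite.op_mul,
      ← MulOpposite.op_mul, ← MulOpposite.op_add, ← Algebra.commutes, ← Algebra.smul_def,
      conjSym_act, conjSym_diffOp, incl_mul_t, act_reflection_reflection, diffOp_act, map_neg,
      smul_neg, neg_add_cancel_right]

/-- `•` as a ring homomorphism from `ℍ` to its opposite ring. -/
def bulletHom : Hecke Δ k →+* (Hecke Δ k)ᵐᵒᵖ :=
  RingQuot.lift ⟨bulletFree Δ k, fun _ _ h => bulletFree_rel Δ k h⟩

/-- The star operation `•` of `ℍ`: the conjugate linear anti-automorphism with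
`t_w ↦ t_{w⁻¹}` and `ω ↦ conj ω` for `ω ∈ V_ℂ`. -/
def bullet (h : Hecke Δ k) : Hecke Δ k := (bulletHom Δ k h).unop

lemma bulletHom_mk (x : FreeAlg P) : bulletHom Δ k (mk Δ k x) = bulletFree Δ k x := by
  have h : mk Δ k x = RingQuot.mkRingHom (Rel Δ k) x := by
    rw [← RingQuot.mkAlgHom_coe ℂ]; rfl
  rw [h]
  exact RingQuot.lift_mkRingHom_apply _ _ _

@[simp] lemma bullet_t (w : W P) : bullet Δ k (t Δ k w) = t Δ k w⁻¹ := by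
  simp only [bullet]
  exact congrArg _ ((bulletHom_mk Δ k _).trans (bulletFree_symT Δ k w))

@[simp] lemma bullet_incl (a : SymAlg V) : bullet Δ k (incl Δ k a) = incl Δ k (conjSym a) := by
  simp only [bullet]
  exact congrArg _ ((bulletHom_mk Δ k _).trans (bulletFree_symA Δ k a))

@[simp] lemma bullet_algebraMap (z : ℂ) :
    bullet Δ k (algebraMap ℂ _ z) = algebraMap ℂ _ (conj z) := by
  rw [← AlgHom.commutes (incl Δ k), bullet_incl, conjSym_algebraMap, AlgHom.commutes]

@[simp] lemma bullet_add (x y : Hecke Δ k) :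
    bullet Δ k (x + y) = bullet Δ k x + bullet Δ k y := by simp [bullet]

@[simp] lemma bullet_mul (x y : Hecke Δ k) :
    bullet Δ k (x * y) = bullet Δ k y * bullet Δ k x := by simp [bullet]

lemma bullet_smul (z : ℂ) (x : Hecke Δ k) :
    bullet Δ k (z • x) = conj z • bullet Δ k x := by
  rw [Algebra.smul_def, bullet_mul, bullet_algebraMap, ← Algebra.commutes, Algebra.smul_def]

lemma bullet_bullet (x : Hecke Δ k) : bullet Δ k (bullet Δ k x) = x := by
  let f : Hecke Δ k →+* Hecke Δ k :=
    { toFun := fun x => bullet Δ k (bullet Δ k x)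
      map_one' := by simp [bullet]
      map_mul' := by simp
      map_zero' := by simp [bullet]
      map_add' := by simp }
  have : f = RingHom.id _ := hecke_ringHom_ext Δ k (by simp [f]) (by simp [f]) (by simp [f])
  exact congrArg (fun g : Hecke Δ k →+* Hecke Δ k => g x) this

/-! ### Modules: weights, central character, invariant forms -/

variable (X : Type*) [AddCommGroup X] [Module ℂ X] [Module (Hecke Δ k) X]
  [IsScalarTower ℂ (Hecke Δ k) X]

/-- The generalized weight space `X_μ`: the `x` such that for every `a ∈ S(V_ℂ)` some power of
`a - (a, μ)` kills `x`. -/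
def weightSpace (μ : Cx V') : Submodule ℂ X :=
  ⨅ a : SymAlg V, Module.End.maxGenEigenspace (Algebra.lsmul ℂ ℂ X (incl Δ k a)) (ev P μ a)

/-- The set `Ω(X) ⊆ V'_ℂ` of `𝔸`-weights of `X`. -/
def weights : Set (Cx V') := {μ | weightSpace Δ k X μ ≠ ⊥}

/-- `X` has central character (the `W`-orbit of) `μ`: the center `S(V_ℂ)^W` of `ℍ` acts on `X`
by evaluation at `μ`. -/
def HasCentralCharacter (μ : Cx V') : Prop :=
  ∀ a : SymAlg V, (∀ w : W P, act (w : V ≃ₗ[ℝ] V) a = a) →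
    ∀ x : X, incl Δ k a • x = ev P μ a • x

/-- The central character of `X` is real: it is represented by an element of `V' ⊆ V'_ℂ`. -/
def HasRealCentralCharacter : Prop := ∃ u : V', HasCentralCharacter Δ k X (1 ⊗ₜ u)

/-- `B` is a `•`-invariant hermitian form on `X` (linear in the first variable). -/
structure IsInvariantHermitian (B : X →ₗ[ℂ] X →ₗ⋆[ℂ] ℂ) : Prop where
  hermitian : ∀ x y, conj (B x y) = B y x
  invariant : ∀ (h : Hecke Δ k) (x y : X), B (h • x) y = B x (bullet Δ k h • y)

/-- `X` admits a nondegenerate `•`-invariant hermitian form. -/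
def AdmitsBulletForm : Prop :=
  ∃ B : X →ₗ[ℂ] X →ₗ⋆[ℂ] ℂ, IsInvariantHermitian Δ k X B ∧
    ∀ x, (∀ y, B x y = 0) → x = 0

end Root

end

end GradedHecke

namespace GradedHecke

noncomputable section

section Combinatorics

variable {I V V' : Type*} [AddCommGroup V] [Module ℝ V] [AddCommGroup V'] [Module ℝ V']
  {P : RootPairing I ℝ V V'} (Δ : SimpleRoots P)

/-! ### Positivity -/

/-! A `•`-invariant form on `X` is the same as an `ℍ`-map from `X` to its hermitian dual `HDual X`.
The dual of a simple module is simple (`simpleStable_hDual`), and its weights are the conjugates of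
those of `X` (`mem_wts_hDual_iff`). Everything therefore rests on one rigidity statement,
`exists_isStableGraph`: two simple modules with the same set of weights are isomorphic.

Rigidity is proved for every parabolic subalgebra `ℍ_J`, generated by `S(V_ℂ)` and the `t_{s_j}`
with `j ∈ J`, by induction on `J` in the spirit of the Langlands classification. If some weight is
nonzero on some root in `J`, a convexity argument (`exists_selection`) produces `f ∈ V` and an
eigenvalue `c` with two properties. The set `K` of those `j ∈ J` whose coroots kill `f` is smaller
than `J`. For each weight `μ` with `(f, μ) = c` and each nontrivial minimal representative `w` of a
coset in `W_J / W_K`, also `(w⁻¹ f, μ) ≠ c`. Then an `ℍ_K`-stable subspace of the generalized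
`c`-eigenspace of `f` is recovered from the `ℍ_J`-module it generates (`stableSpan_inf_genEig_le`).
Hence the eigenspaces in the two modules are simple over `ℍ_K`, they are isomorphic by induction,
and the graph of that isomorphism generates the graph of an isomorphism over `ℍ_J`.

If all weights vanish on the roots in `J`, let `x`, `x'` be vectors of a common weight. Since `k`
has no zeros, the `t_w x`, `w ∈ W_J`, are linearly independent (`coeff_eq_zero`), and likewise for
`x'`. So the module generated by `(x, x')` contains neither factor, and by simplicity it is a graph.

Two supplements complete the proof. Simple modules are finite dimensional
(`finiteDimensional_of_isSimpleModule`), and a real central character forces every weight to be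
real. Conversely, a nondegenerate invariant form makes the annihilator of `X` in `S(V_ℂ)` stable
under conjugation; the weights are the zeros of that annihilator (`mem_wts_top_iff`). -/

lemma exists_coord : ∃ ξ : Δ.carrier → V →ₗ[ℝ] ℝ,
    ∀ i j : Δ.carrier, ξ i (P.root j) = Finsupp.single j (1 : ℝ) i := by
  have hli : LinearIndependent ℝ (fun i : Δ.carrier => P.root i) := Δ.linearIndepOn
  have (i : Δ.carrier) := LinearMap.exists_extend (Finsupp.lapply i ∘ₗ hli.repr)
  choose ξ hξ using this
  refine ⟨ξ, fun i j => ?_⟩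
  have hj : P.root j ∈ Submodule.span ℝ (Set.range fun i : Δ.carrier => P.root i) :=
    Submodule.subset_span ⟨j, rfl⟩
  have := LinearMap.congr_fun (hξ i) ⟨P.root j, hj⟩
  simp only [LinearMap.comp_apply, Submodule.subtype_apply] at this
  rw [this]
  have h2 : hli.repr ⟨P.root j, hj⟩ = Finsupp.single j 1 :=
    hli.repr_eq_single j _ rfl
  simp [h2]

/-- Linear functionals on `V` that are dual to the simple roots. -/
def coord : Δ.carrier → V →ₗ[ℝ] ℝ := (exists_coord Δ).choose

open Classical in
lemma coord_root (i j : Δ.carrier) : coord Δ i (P.root j) = if j = i then 1 else 0 := by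
  rw [coord, (exists_coord Δ).choose_spec i j, Finsupp.single_apply]

/-- A vector is positive if it is a nonnegative combination of simple roots. -/
def IsPos (v : V) : Prop := v ∈ Submodule.span ℝ≥0 (P.root '' Δ.carrier)

variable {Δ}

lemma IsPos.nonneg {v : V} (h : IsPos Δ v) (g : V →ₗ[ℝ] ℝ)
    (hg : ∀ i : Δ.carrier, 0 ≤ g (P.root i)) : 0 ≤ g v := by
  induction h using Submodule.span_induction with
  | mem x hx => obtain ⟨i, hi, rfl⟩ := hx; exact hg ⟨i, hi⟩
  | zero => simp
  | add x y _ _ hx hy => rw [map_add]; positivity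
  | smul r x _ hx =>
    have : r • x = (r : ℝ) • x := rfl
    rw [this, map_smul, smul_eq_mul]; positivity

lemma IsPos.coord_nonneg {v : V} (h : IsPos Δ v) (i : Δ.carrier) : 0 ≤ coord Δ i v := by
  classical
  refine h.nonneg _ fun j => ?_
  rw [coord_root]; split_ifs <;> norm_num

lemma IsPos.mem_span {v : V} (h : IsPos Δ v) : v ∈ Submodule.span ℝ (P.root '' Δ.carrier) :=
  Submodule.span_subset_span ℝ≥0 ℝ _ h

lemma eq_sum_coord [Fintype Δ.carrier] {v : V} (h : v ∈ Submodule.span ℝ (P.root '' Δ.carrier)) :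
    v = ∑ i, coord Δ i v • P.root i := by
  classical
  induction h using Submodule.span_induction with
  | mem x hx =>
    obtain ⟨i, hi, rfl⟩ := hx
    have := fun j => coord_root Δ j ⟨i, hi⟩
    simp only at this
    rw [Finset.sum_eq_single (⟨i, hi⟩ : Δ.carrier)]
    · rw [this]; simp
    · intro b _ hb; rw [this, if_neg (Ne.symm hb), zero_smul]
    · simp
  | zero => simp
  | add x y _ _ hx hy =>
    simp only [map_add, add_smul, Finset.sum_add_distrib]; rw [← hx, ← hy]
  | smul r x _ hx =>
    simp only [map_smul, smul_eq_mul, mul_smul]; rw [← Finset.smul_sum, ← hx]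

lemma isPos_root (i : Δ.carrier) : IsPos Δ (P.root i) := Submodule.subset_span ⟨i, i.2, rfl⟩

lemma isPos_neg_root {i : I} (h : ¬ IsPos Δ (P.root i)) : IsPos Δ (-P.root i) :=
  (Δ.pos_or_neg i).resolve_left h

/-! ### The Weyl group and words in simple reflections -/

@[simp] lemma coe_weylRefl (i : I) : ((weylRefl P i : W P) : V ≃ₗ[ℝ] V) = P.reflection i := rfl

/-- The compatibility with coroots is carried along because it is what gives `w s_i w⁻¹ = s_j`; the
roots need not span `V`, so the action on roots alone does not say it. -/
lemma exists_root_eq (w : W P) (i : I) :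
    ∃ j, (w : V ≃ₗ[ℝ] V) (P.root i) = P.root j ∧
      ∀ v, P.coroot' j ((w : V ≃ₗ[ℝ] V) v) = P.coroot' i v := by
  obtain ⟨w, hw⟩ := w
  simp only
  induction hw using Subgroup.closure_induction'' generalizing i with
  | one => exact ⟨i, rfl, fun v => rfl⟩
  | mem x hx =>
    obtain ⟨l, rfl⟩ := hx
    exact ⟨P.reflectionPerm l i, (P.root_reflectionPerm l i).symm, fun v => by
      rw [← P.coroot'_reflection, P.reflection_same]⟩
  | inv_mem x hx =>
    obtain ⟨l, rfl⟩ := hx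
    rw [P.reflection_inv]
    exact ⟨P.reflectionPerm l i, (P.root_reflectionPerm l i).symm, fun v => by
      rw [← P.coroot'_reflection, P.reflection_same]⟩
  | mul x y _ _ hx hy =>
    obtain ⟨j, hj, hj'⟩ := hy i
    obtain ⟨l, hl, hl'⟩ := hx j
    exact ⟨l, by rw [LinearEquiv.mul_apply, hj, hl], fun v => by
      rw [LinearEquiv.mul_apply, hl', hj']⟩

lemma mul_weylRefl {w : W P} {i j : I} (h : (w : V ≃ₗ[ℝ] V) (P.root i) = P.root j) :
    w * weylRefl P i = weylRefl P j * w := by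
  obtain ⟨l, hl, hl'⟩ := exists_root_eq w i
  obtain rfl : l = j := P.root.injective (hl.symm.trans h)
  ext v
  simp only [Subgroup.coe_mul, LinearEquiv.mul_apply, coe_weylRefl, P.reflection_apply, map_sub,
    map_smul, hl, hl']

/-- The product of a word in the simple reflections. -/
def wp (L : List Δ.carrier) : W P := (L.map fun i => weylRefl P (i : I)).prod

@[simp] lemma wp_nil : wp ([] : List Δ.carrier) = 1 := rfl

@[simp] lemma wp_cons (i : Δ.carrier) (L : List Δ.carrier) :
    wp (i :: L) = weylRefl P (i : I) * wp L := by simp [wp]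

@[simp] lemma wp_append (L L' : List Δ.carrier) : wp (L ++ L') = wp L * wp L' := by simp [wp]

lemma weylRefl_inv (i : I) : (weylRefl P i)⁻¹ = weylRefl P i :=
  inv_eq_of_mul_eq_one_left (weylRefl_mul_self P i)

lemma wp_reverse (L : List Δ.carrier) : wp L.reverse = (wp L)⁻¹ := by
  induction L with
  | nil => simp
  | cons i L ih => simp [ih, weylRefl_inv]

lemma isPos_or_isPos_neg (w : W P) (i : I) : IsPos Δ ((w : V ≃ₗ[ℝ] V) (P.root i)) ∨
    IsPos Δ (-(w : V ≃ₗ[ℝ] V) (P.root i)) := by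
  obtain ⟨j, hj, -⟩ := exists_root_eq w i
  rw [hj]
  exact Δ.pos_or_neg j

variable [Finite I]

lemma eq_zero_of_isPos_of_isPos_neg {v : V} (h : IsPos Δ v) (h' : IsPos Δ (-v)) : v = 0 := by
  have := Fintype.ofFinite Δ.carrier
  rw [eq_sum_coord h.mem_span]
  refine Finset.sum_eq_zero fun i _ => ?_
  have h1 := h.coord_nonneg i
  have h2 := h'.coord_nonneg i
  rw [map_neg] at h2
  rw [show coord Δ i v = 0 by linarith, zero_smul]

lemma not_isPos_neg_root {i : I} (h : IsPos Δ (P.root i)) : ¬ IsPos Δ (-P.root i) :=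
  fun h' => P.ne_zero i (eq_zero_of_isPos_of_isPos_neg h h')

/-- A simple reflection permutes the positive roots other than its own simple root. -/
lemma isPos_reflection [P.IsReduced] (i : Δ.carrier) {j : I} (hj : IsPos Δ (P.root j))
    (hne : P.root j ≠ P.root i) : IsPos Δ (P.reflection i (P.root j)) := by
  classical
  have := Fintype.ofFinite Δ.carrier
  rw [← P.root_reflectionPerm]
  by_contra hcon
  have hneg := isPos_neg_root hcon
  rw [P.root_reflectionPerm, P.reflection_apply] at hneg
  -- `s_i` changes only the `i`-th coordinate. If the image were negative, all other coordinates
  -- would vanish, so the root would be proportional to the simple root `i`, against reducedness.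
  have hz : ∀ l : Δ.carrier, l ≠ i → coord Δ l (P.root j) = 0 := by
    intro l hl
    have h1 := hneg.coord_nonneg l
    have h2 := hj.coord_nonneg l
    rw [map_neg, map_sub, map_smul, coord_root, if_neg (Ne.symm hl)] at h1
    simp at h1
    linarith
  have hs := eq_sum_coord hj.mem_span
  rw [Finset.sum_eq_single i (fun l _ hl => by rw [hz l hl, zero_smul]) (by simp)] at hs
  have hdep : ¬ LinearIndependent ℝ ![P.root j, P.root i] := by
    rw [LinearIndependent.pair_iff]
    push Not
    refine ⟨1, -coord Δ i (P.root j), ?_, by simp⟩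
    rw [one_smul, neg_smul, ← hs]; simp
  rcases RootPairing.IsReduced.eq_or_eq_neg j i hdep with h | h
  · exact hne h
  · rw [h] at hj
    exact not_isPos_neg_root (isPos_root i) hj

/-- Apply the letters from right to left. At the letter `j` where the image of the root `i` turns
negative, this image must be the simple root `j` itself, since `s_j` keeps all other positive roots
positive. Conjugation then turns `s_j w'` into `w' s_i`, where `w'` is the product of the letters to
its right, and multiplying by `s_i` on the right deletes that letter. -/
lemma exchange [P.IsReduced] (L : List Δ.carrier) (i : Δ.carrier)
    (h : ¬ IsPos Δ ((wp L : V ≃ₗ[ℝ] V) (P.root i))) :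
    ∃ L' : List Δ.carrier, L'.length + 1 = L.length ∧ (∀ j ∈ L', j ∈ L) ∧
      wp L' = wp L * weylRefl P (i : I) := by
  induction L with
  | nil => exact absurd (isPos_root i) h
  | cons j L ih =>
    by_cases h1 : IsPos Δ ((wp L : V ≃ₗ[ℝ] V) (P.root i))
    · obtain ⟨l, hl, -⟩ := exists_root_eq (wp L) i
      have hlj : P.root l = P.root j := by
        by_contra hne
        rw [hl] at h1
        refine h ?_
        rw [wp_cons, Subgroup.coe_mul, LinearEquiv.mul_apply, hl]
        exact isPos_reflection j h1 hne
      refine ⟨L, rfl, fun _ => List.mem_cons_of_mem _, ?_⟩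
      rw [wp_cons, mul_assoc, mul_weylRefl (hl.trans hlj), ← mul_assoc, weylRefl_mul_self, one_mul]
    · obtain ⟨L', hL', hmem, hw⟩ := ih h1
      refine ⟨j :: L', by simp [hL'], ?_, by rw [wp_cons, hw, wp_cons, mul_assoc]⟩
      intro l hl
      rcases List.mem_cons.1 hl with rfl | hl
      · exact List.mem_cons_self
      · exact List.mem_cons_of_mem _ (hmem l hl)

/-- If the last letter `j` keeps its root positive under the whole word, the word without `j` sends
that root to a negative one, so `exchange` gives a shorter word with the same product. Testing only
the letters that occur lets the statement apply inside any parabolic subgroup. -/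
lemma wp_eq_one [P.IsReduced] (L : List Δ.carrier)
    (h : ∀ j ∈ L, IsPos Δ ((wp L : V ≃ₗ[ℝ] V) (P.root j))) : wp L = 1 := by
  induction hn : L.length using Nat.strong_induction_on generalizing L with
  | _ n ih =>
    rcases List.eq_nil_or_concat L with rfl | ⟨L0, j, rfl⟩
    · rfl
    · rw [List.concat_eq_append] at *
      have hw : wp (L0 ++ [j]) = wp L0 * weylRefl P (j : I) := by simp
      have h1 := h j (by simp)
      rw [hw, Subgroup.coe_mul, LinearEquiv.mul_apply, coe_weylRefl, P.reflection_apply_self,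
        map_neg] at h1
      have h2 : ¬ IsPos Δ ((wp L0 : V ≃ₗ[ℝ] V) (P.root j)) := by
        obtain ⟨l, hl, -⟩ := exists_root_eq (wp L0) j
        rw [hl] at h1 ⊢
        exact fun h3 => not_isPos_neg_root h3 h1
      obtain ⟨L', hL', hmem, hw'⟩ := exchange L0 j h2
      rw [hw, ← hw']
      refine ih L'.length (by simp at hn; omega) L' (fun l hl => ?_) rfl
      rw [hw', ← hw]
      exact h l (List.mem_append_left _ (hmem l hl))

lemma exists_not_isPos [P.IsReduced] {L : List Δ.carrier} (h : wp L ≠ 1) :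
    ∃ j ∈ L, ¬ IsPos Δ ((wp L : V ≃ₗ[ℝ] V) (P.root j)) := by
  by_contra! hcon
  exact h (wp_eq_one L hcon)

end Combinatorics

end

end GradedHecke

namespace GradedHecke

noncomputable section

/-! ### Parabolic subgroups preserve the span of their simple roots -/

section Span

variable {I V V' : Type*} [AddCommGroup V] [Module ℝ V] [AddCommGroup V'] [Module ℝ V']
  {P : RootPairing I ℝ V V'} {Δ : SimpleRoots P}

lemma wp_mem_span {J : Set Δ.carrier} {L : List Δ.carrier} (hL : ∀ i ∈ L, i ∈ J) {v : V}
    (hv : v ∈ Submodule.span ℝ ((fun i : Δ.carrier => P.root i) '' J)) :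
    (wp L : V ≃ₗ[ℝ] V) v ∈ Submodule.span ℝ ((fun i : Δ.carrier => P.root i) '' J) := by
  induction L with
  | nil => simpa using hv
  | cons i L ih =>
    rw [wp_cons, Subgroup.coe_mul, LinearEquiv.mul_apply, coe_weylRefl, P.reflection_apply]
    refine Submodule.sub_mem _ (ih fun j hj => hL j (List.mem_cons_of_mem _ hj))
      (Submodule.smul_mem _ _ (Submodule.subset_span ⟨i, hL i List.mem_cons_self, rfl⟩))

end Span

section InvariantForm

variable {I V V' : Type*} [AddCommGroup V] [Module ℝ V] [AddCommGroup V'] [Module ℝ V']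
  (P : RootPairing I ℝ V V') [Finite I]

/-! ### The invariant form, and generation by simple reflections -/

/-- The canonical `W`-invariant positive semidefinite form on `V`. -/
def form : LinearMap.BilinForm ℝ V :=
  letI := Fintype.ofFinite I
  P.RootForm

lemma form_comm (v w : V) : form P v w = form P w v := by
  let := Fintype.ofFinite I
  simp only [form, RootPairing.rootForm_apply_apply, mul_comm]

lemma form_reflection (i : I) (v w : V) :
    form P (P.reflection i v) (P.reflection i w) = form P v w := by
  let := Fintype.ofFinite I
  exact P.rootForm_reflection_reflection_apply i v w

lemma form_pos {v : V} (hv : v ∈ Submodule.span ℝ (Set.range P.root)) (h : v ≠ 0) :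
    0 < form P v v := by
  let := Fintype.ofFinite I
  exact P.rootForm_pos_of_ne_zero hv h

lemma form_root_pos (i : I) : 0 < form P (P.root i) (P.root i) :=
  form_pos P (Submodule.subset_span ⟨i, rfl⟩) (P.ne_zero i)

/-- Invariance of the form under `s_i`, applied to `v` and the root `i`. It lets signs and zeros of
coroots be read off from the form. -/
lemma two_mul_form_root (v : V) (i : I) :
    2 * form P v (P.root i) = P.coroot' i v * form P (P.root i) (P.root i) := by
  have h := form_reflection P i v (P.root i)
  rw [P.reflection_apply_self, P.reflection_apply] at h
  simp only [map_sub, map_neg, LinearMap.sub_apply, map_smul, LinearMap.smul_apply,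
    smul_eq_mul] at h
  linarith

lemma coroot_pos_iff (v : V) (i : I) : 0 < P.coroot' i v ↔ 0 < form P v (P.root i) := by
  have h := two_mul_form_root P v i
  have h' := form_root_pos P i
  constructor
  · intro hv; nlinarith [mul_pos hv h']
  · intro hv
    by_contra hcon
    nlinarith

lemma coroot_eq_zero_iff (v : V) (i : I) : P.coroot' i v = 0 ↔ form P v (P.root i) = 0 := by
  have h := two_mul_form_root P v i
  have h' := form_root_pos P i
  constructor
  · intro hv; rw [hv] at h; linarith
  · intro hv
    rw [hv, mul_zero, eq_comm, mul_eq_zero] at h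
    exact h.resolve_right h'.ne'

variable {P}

lemma form_weyl (w : W P) (v v' : V) :
    form P ((w : V ≃ₗ[ℝ] V) v) ((w : V ≃ₗ[ℝ] V) v') = form P v v' := by
  obtain ⟨w, hw⟩ := w
  simp only
  induction hw using Subgroup.closure_induction'' generalizing v v' with
  | one => rfl
  | mem x hx => obtain ⟨l, rfl⟩ := hx; exact form_reflection P l v v'
  | inv_mem x hx =>
    obtain ⟨l, rfl⟩ := hx; rw [P.reflection_inv]; exact form_reflection P l v v'
  | mul x y _ _ hx hy => rw [LinearEquiv.mul_apply, LinearEquiv.mul_apply, hx, hy]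

variable {Δ : SimpleRoots P}

/-- A functional that is nonnegative on the simple roots in `J` is nonnegative on positive
combinations lying in their span. -/
lemma IsPos.nonneg_of_mem_span {v : V} (h : IsPos Δ v) {J : Set Δ.carrier}
    (hv : v ∈ Submodule.span ℝ ((fun i : Δ.carrier => P.root i) '' J)) (g : V →ₗ[ℝ] ℝ)
    (hg : ∀ i ∈ J, 0 ≤ g (P.root i)) : 0 ≤ g v := by
  classical
  have := Fintype.ofFinite Δ.carrier
  have hz : ∀ i ∉ J, coord Δ i v = 0 := by
    clear h
    intro i hi
    induction hv using Submodule.span_induction with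
    | mem x hx =>
      obtain ⟨l, hl, rfl⟩ := hx
      rw [coord_root, if_neg]
      rintro rfl; exact hi hl
    | zero => simp
    | add x y _ _ hx hy => rw [map_add, hx, hy, add_zero]
    | smul r x _ hx => rw [map_smul, hx, smul_zero]
  rw [eq_sum_coord h.mem_span, map_sum]
  refine Finset.sum_nonneg fun i _ => ?_
  rw [map_smul, smul_eq_mul]
  by_cases hi : i ∈ J
  · exact mul_nonneg (h.coord_nonneg i) (hg i hi)
  · rw [hz i hi, zero_mul]

variable [P.IsReduced]

/-- Descent on height, the sum of the simple coordinates. Heights are real numbers here, so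
termination comes from the finiteness of the set of roots: a counterexample of least height is
reflected to a positive root of smaller height. -/
lemma exists_wp_root {i : I} (hi : IsPos Δ (P.root i)) :
    ∃ (L : List Δ.carrier) (j : Δ.carrier), P.root i = (wp L : V ≃ₗ[ℝ] V) (P.root j) := by
  classical
  have := Fintype.ofFinite Δ.carrier
  let ht : V →ₗ[ℝ] ℝ := ∑ j, coord Δ j
  have hts : ∀ j : Δ.carrier, ht (P.root j) = 1 := fun j => by
    simp [ht, coord_root]
  by_contra hcon
  obtain ⟨i, ⟨hi, hmin⟩, hle⟩ := Set.exists_min_image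
    {i | IsPos Δ (P.root i) ∧ ¬ ∃ (L : List Δ.carrier) (j : Δ.carrier),
      P.root i = (wp L : V ≃ₗ[ℝ] V) (P.root j)} (fun i => ht (P.root i)) (Set.toFinite _) ⟨i, hi, hcon⟩
  -- Otherwise pairing with the root `i` would be nonpositive on all positive vectors, including the
  -- root `i` itself.
  obtain ⟨j, hj⟩ : ∃ j : Δ.carrier, 0 < form P (P.root i) (P.root j) := by
    by_contra! hneg
    have := hi.nonneg (-(form P (P.root i))) (fun j => by
      rw [LinearMap.neg_apply]; linarith [hneg j])
    rw [LinearMap.neg_apply] at this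
    linarith [form_root_pos P i]
  have hne : P.root i ≠ P.root j := fun h => hmin ⟨[], j, by simpa using h⟩
  have hpos := isPos_reflection j hi hne
  have hcp := (coroot_pos_iff P _ _).2 hj
  have hlt : ht (P.reflection j (P.root i)) < ht (P.root i) := by
    rw [P.reflection_apply, map_sub, map_smul, hts]
    simpa using hcp
  rw [← P.root_reflectionPerm] at hpos hlt
  by_cases hex : ∃ (L : List Δ.carrier) (l : Δ.carrier),
      P.root (P.reflectionPerm j i) = (wp L : V ≃ₗ[ℝ] V) (P.root l)
  · obtain ⟨L, l, h⟩ := hex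
    refine hmin ⟨j :: L, l, ?_⟩
    rw [wp_cons, Subgroup.coe_mul, LinearEquiv.mul_apply, ← h, P.root_reflectionPerm, coe_weylRefl,
      P.reflection_same]
  · exact absurd (hle _ ⟨hpos, hex⟩) (not_le.2 hlt)

variable (Δ) in
/-- The Weyl group is generated by the simple reflections. -/
lemma exists_wp_eq (w : W P) : ∃ L : List Δ.carrier, wp L = w := by
  have key : ∀ i : I, ∃ L : List Δ.carrier, wp L = weylRefl P i := by
    have hpos : ∀ i : I, IsPos Δ (P.root i) → ∃ L : List Δ.carrier, wp L = weylRefl P i := by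
      intro i hi
      obtain ⟨L, j, h⟩ := exists_wp_root hi
      refine ⟨L ++ [j] ++ L.reverse, ?_⟩
      have := mul_weylRefl h.symm
      simp only [wp_append, wp_cons, wp_nil, mul_one, wp_reverse, this]
      rw [mul_assoc, mul_inv_cancel, mul_one]
    intro i
    rcases Δ.pos_or_neg i with hi | hi
    · exact hpos i hi
    · have h1 : P.root (P.reflectionPerm i i) = -P.root i := by
        rw [P.root_reflectionPerm, P.reflection_apply_self]
      obtain ⟨L, hL⟩ := hpos (P.reflectionPerm i i) (by rw [h1]; exact hi)
      refine ⟨L, hL.trans ?_⟩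
      ext v
      simp only [coe_weylRefl]
      rw [P.reflection_reflectionPerm, LinearEquiv.mul_apply, LinearEquiv.mul_apply,
        P.reflection_same]
  obtain ⟨w, hw⟩ := w
  induction hw using Subgroup.closure_induction'' with
  | one => exact ⟨[], rfl⟩
  | mem x hx => obtain ⟨l, rfl⟩ := hx; exact key l
  | inv_mem x hx =>
    obtain ⟨l, rfl⟩ := hx
    obtain ⟨L, hL⟩ := key l
    exact ⟨L, hL.trans (Subtype.ext (P.reflection_inv (i := l)).symm)⟩
  | mul x y hx hy ihx ihy =>
    obtain ⟨L, hL⟩ := ihx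
    obtain ⟨L', hL'⟩ := ihy
    exact ⟨L ++ L', by rw [wp_append, hL, hL']; rfl⟩

/-- `W` acts faithfully on the finite set of roots. Since the roots need not span `V`, faithfulness
is not automatic: an element fixing every root keeps the simple roots positive, so it is trivial by
`wp_eq_one`. -/
theorem finite_weyl (Δ : SimpleRoots P) : Finite (W P) := by
  choose perm hperm _ using fun (w : W P) (i : I) => exists_root_eq w i
  refine Finite.of_injective perm fun w w' h => ?_
  obtain ⟨L, hL⟩ := exists_wp_eq Δ (w'⁻¹ * w)
  have h1 : wp L = 1 := wp_eq_one L fun j _ => by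
    have : (w : V ≃ₗ[ℝ] V) (P.root j) = (w' : V ≃ₗ[ℝ] V) (P.root j) := by
      rw [hperm w, hperm w', h]
    rw [hL, Subgroup.coe_mul, LinearEquiv.mul_apply, this, ← LinearEquiv.mul_apply,
      ← Subgroup.coe_mul, inv_mul_cancel]
    exact isPos_root j
  rw [hL, inv_mul_eq_one] at h1
  exact h1.symm

end InvariantForm

end

end GradedHecke

namespace GradedHecke

noncomputable section

/-! ### Projection to a convex cone -/

section Projection

/-- Projection to a closed convex cone given by finitely many linear inequalities, for a positive
definite form. -/
lemma exists_cone_projection {E : Type*} [AddCommGroup E] [Module ℝ E] [FiniteDimensional ℝ E]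
    (B : LinearMap.BilinForm ℝ E) (hs : ∀ v w, B v w = B w v) (hp : ∀ v, v ≠ 0 → 0 < B v v)
    {ι : Type*} (g : ι → E →ₗ[ℝ] ℝ) (x : E →ₗ[ℝ] ℝ) :
    ∃ f : E, (∀ i, 0 ≤ g i f) ∧ (∀ v, (∀ i, 0 ≤ g i v) → x v ≤ B f v) ∧ x f = B f f := by
  have hnn : ∀ v, 0 ≤ B v v := fun v => by
    by_cases h : v = 0
    · simp [h]
    · exact (hp v h).le
  let core : InnerProductSpace.Core ℝ E :=
    { inner := fun v w => B v w
      conj_inner_symm := fun v w => by simpa using hs w v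
      re_inner_nonneg := fun v => by simpa using hnn v
      add_left := fun u v w => by simp
      smul_left := fun u v r => by simp
      definite := fun v hv => by
        by_contra h
        exact (hp v h).ne' hv }
  let : NormedAddCommGroup E := core.toNormedAddCommGroup
  let : InnerProductSpace ℝ E := InnerProductSpace.ofCore core.toCore
  have hinner : ∀ v w : E, inner ℝ v w = B v w := fun v w => rfl
  have : CompleteSpace E := FiniteDimensional.complete ℝ E
  -- `u` is the Riesz representative of `x`; the vector sought is the point of the cone nearest to
  -- `u`.
  obtain ⟨u, hu⟩ : ∃ u : E, ∀ v, x v = B u v := by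
    refine ⟨(InnerProductSpace.toDual ℝ E).symm (LinearMap.toContinuousLinearMap x), fun v => ?_⟩
    rw [← hinner, InnerProductSpace.toDual_symm_apply]; rfl
  let K : Set E := {v | ∀ i, 0 ≤ g i v}
  have hK0 : (0 : E) ∈ K := fun i => by simp
  have hKc : IsClosed K := by
    have : K = ⋂ i, {v | 0 ≤ g i v} := by ext; simp [K]
    rw [this]
    exact isClosed_iInter fun i => isClosed_le continuous_const
      (LinearMap.continuous_of_finiteDimensional _)
  have hKv : Convex ℝ K := by
    intro v hv w hw a b ha hb _ i
    rw [map_add, map_smul, map_smul, smul_eq_mul, smul_eq_mul]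
    exact add_nonneg (mul_nonneg ha (hv i)) (mul_nonneg hb (hw i))
  obtain ⟨f, hf, hmin⟩ := exists_norm_eq_iInf_of_complete_convex ⟨0, hK0⟩ hKc.isComplete hKv u
  rw [norm_eq_iInf_iff_real_inner_le_zero hKv hf] at hmin
  -- Testing the variational inequality at `0` and at `2f` shows that `u - f` is orthogonal to `f`.
  have h0 := hmin 0 hK0
  have h2 := hmin ((2 : ℝ) • f) (fun i => by
    rw [map_smul, smul_eq_mul]; exact mul_nonneg (by norm_num) (hf i))
  rw [two_smul, add_sub_cancel_right] at h2
  rw [zero_sub, inner_neg_right] at h0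
  have h3 : inner ℝ (u - f) f = 0 := by linarith
  refine ⟨f, hf, fun v hv => ?_, ?_⟩
  · have h4 := hmin v hv
    rw [inner_sub_right, h3, sub_zero, inner_sub_left, hinner, hinner] at h4
    rw [hu]; linarith
  · rw [inner_sub_left, hinner, hinner] at h3
    rw [hu]; linarith

end Projection

/-! ### Choice of a separating direction for a finite set of weights -/

section Selection

variable {I V V' : Type*} [AddCommGroup V] [Module ℝ V] [AddCommGroup V'] [Module ℝ V']
  {P : RootPairing I ℝ V V'} {Δ : SimpleRoots P}

/-- The real span of the simple roots in `J`. -/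
abbrev spanJ (J : Set Δ.carrier) : Submodule ℝ V :=
  Submodule.span ℝ ((fun i : Δ.carrier => P.root i) '' J)

lemma root_mem_spanJ {J : Set Δ.carrier} {i : Δ.carrier} (hi : i ∈ J) : P.root i ∈ spanJ J :=
  Submodule.subset_span ⟨i, hi, rfl⟩

variable [Finite I]

instance (J : Set Δ.carrier) : FiniteDimensional ℝ (spanJ J) :=
  FiniteDimensional.span_of_finite ℝ (Set.toFinite _)

lemma form_pos_of_mem_spanJ {J : Set Δ.carrier} {v : V} (hv : v ∈ spanJ J) (h : v ≠ 0) :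
    0 < form P v v :=
  form_pos P (Submodule.span_mono (by rintro _ ⟨i, _, rfl⟩; exact ⟨i, rfl⟩) hv) h

lemma exists_cone_projection_spanJ (J : Set Δ.carrier) (x : V →ₗ[ℝ] ℝ) :
    ∃ f ∈ spanJ J, (∀ i ∈ J, 0 ≤ form P f (P.root i)) ∧
      (∀ v ∈ spanJ J, (∀ i ∈ J, 0 ≤ form P v (P.root i)) → x v ≤ form P f v) ∧
      x f = form P f f := by
  obtain ⟨f, h1, h2, h3⟩ := exists_cone_projection (E := spanJ J)
    ((form P).restrict (spanJ J)) (fun v w => form_comm P v w)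
    (fun v hv => form_pos_of_mem_spanJ v.2 (by simpa using hv))
    (fun i : J => (form P).flip (P.root (i : Δ.carrier)) ∘ₗ (spanJ J).subtype)
    (x ∘ₗ (spanJ J).subtype)
  exact ⟨f, f.2, fun i hi => h1 ⟨i, hi⟩, fun v hv hv' => h2 ⟨v, hv⟩ fun i => hv' i i.2, h3⟩

/-- A strictly dominant vector for the simple roots in `J`. -/
lemma exists_strictly_dominant (J : Set Δ.carrier) :
    ∃ ρ ∈ spanJ J, ∀ i ∈ J, 0 < form P ρ (P.root i) := by
  classical
  have := Fintype.ofFinite Δ.carrier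
  let B := (form P).restrict (spanJ J)
  have hinj : Function.Injective B := by
    rw [← LinearMap.ker_eq_bot, LinearMap.ker_eq_bot']
    intro v hv
    by_contra h
    have h1 := form_pos_of_mem_spanJ v.2 (by simpa using h)
    have h2 : B v v = 0 := by rw [hv]; rfl
    exact h1.ne' h2
  have hsurj : Function.Surjective B :=
    (LinearMap.injective_iff_surjective_of_finrank_eq_finrank
      (Subspace.dual_finrank_eq (K := ℝ) (V := spanJ J)).symm).1 hinj
  -- `ρ` represents the height functional, which takes the value `1` on each simple root.
  obtain ⟨ρ, hρ⟩ := hsurj ((∑ j, coord Δ j) ∘ₗ (spanJ J).subtype)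
  refine ⟨ρ, ρ.2, fun i hi => ?_⟩
  have : form P ρ (P.root i) = (∑ j, coord Δ j) (P.root i) :=
    LinearMap.congr_fun hρ ⟨_, root_mem_spanJ hi⟩
  rw [this]
  simp [coord_root]

lemma form_sub_self (v w : V) :
    form P (v - w) (v - w) = form P v v - 2 * form P v w + form P w w := by
  have := form_comm P v w
  simp only [map_sub, LinearMap.sub_apply]
  linarith

/-- The dominant cone spans: a simple root plus a large multiple of a strictly dominant `ρ` is
dominant. A functional vanishing on the cone would therefore vanish on that simple root. -/
lemma exists_dominant_pos {J : Set Δ.carrier} {x : V →ₗ[ℝ] ℝ} {i : Δ.carrier} (hi : i ∈ J)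
    (hxi : x (P.root i) ≠ 0) :
    ∃ ε : ℝ, (ε = 1 ∨ ε = -1) ∧
      ∃ v ∈ spanJ J, (∀ i ∈ J, 0 ≤ form P v (P.root i)) ∧ 0 < ε * x v := by
  obtain ⟨ρ, hρ, hρpos⟩ := exists_strictly_dominant (P := P) J
  by_contra! hcon
  have hz : ∀ v ∈ spanJ J, (∀ i ∈ J, 0 ≤ form P v (P.root i)) → x v = 0 := fun v hv hvd => by
    have h1 := hcon 1 (Or.inl rfl) v hv hvd
    have h2 := hcon (-1) (Or.inr rfl) v hv hvd
    linarith
  obtain ⟨N, hN⟩ : ∃ N : ℝ, ∀ j : J,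
      -(form P (P.root i) (P.root (j : Δ.carrier))) / form P ρ (P.root (j : Δ.carrier)) ≤ N := by
    obtain ⟨N, hN⟩ := (Set.finite_range fun j : J =>
      -(form P (P.root i) (P.root (j : Δ.carrier))) / form P ρ (P.root (j : Δ.carrier))).bddAbove
    exact ⟨N, fun j => hN ⟨j, rfl⟩⟩
  have h1 := hz (P.root i + N • ρ)
    (Submodule.add_mem _ (root_mem_spanJ hi) (Submodule.smul_mem _ _ hρ)) (fun j hj => by
      simp only [map_add, map_smul, LinearMap.add_apply, LinearMap.smul_apply, smul_eq_mul]
      have h2 := (div_le_iff₀ (hρpos j hj)).1 (hN ⟨j, hj⟩)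
      linarith)
  rw [map_add, map_smul, hz ρ hρ fun j hj => (hρpos j hj).le, smul_zero, add_zero] at h1
  exact hxi h1

variable [P.IsReduced]

/-- Selection of a maximal cone projection among a finite family of functionals. -/
lemma exists_selection_real {Λ : Type*} {Ω : Set Λ} (hΩ : Ω.Finite) (J : Set Δ.carrier)
    (x : Λ → V →ₗ[ℝ] ℝ)
    (hx : ∃ μ ∈ Ω, ∃ v ∈ spanJ J, (∀ i ∈ J, 0 ≤ form P v (P.root i)) ∧ 0 < x μ v) :
    ∃ f ∈ spanJ J, (∃ j ∈ J, form P f (P.root j) ≠ 0) ∧ ∃ μ₀ ∈ Ω, ∀ μ ∈ Ω, x μ f = x μ₀ f →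
      ∀ L : List Δ.carrier, (∀ i ∈ L, i ∈ J) → wp L ≠ 1 →
        (∀ j ∈ J, form P f (P.root j) = 0 → IsPos Δ ((wp L : V ≃ₗ[ℝ] V) (P.root j))) →
        x μ (((wp L)⁻¹ : W P).1 f) ≠ x μ f := by
  have : Finite J := inferInstance
  choose p hpJ hpdom hple hpeq using fun μ => exists_cone_projection_spanJ (P := P) J (x μ)
  obtain ⟨μ₀, hμ₀, hmax⟩ := Set.exists_max_image Ω (fun μ => form P (p μ) (p μ)) hΩ
    (let ⟨μ, hμ, _⟩ := hx; ⟨μ, hμ⟩)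
  set f := p μ₀ with hf
  have hfJ : f ∈ spanJ J := hpJ μ₀
  -- By maximality, `f = 0` would make all projections zero, so that no functional in the family
  -- would be positive on a dominant vector.
  have hf0 : f ≠ 0 := by
    intro h0
    obtain ⟨μ, hμ, v, hv, hvd, hpos⟩ := hx
    have h1 := hmax μ hμ
    simp only [h0, LinearMap.map_zero] at h1
    have h2 : p μ = 0 := by
      by_contra h
      exact absurd (form_pos_of_mem_spanJ (hpJ μ) h) (not_lt.2 h1)
    have h3 := hple μ v hv hvd
    rw [h2, LinearMap.map_zero, LinearMap.zero_apply] at h3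
    linarith
  refine ⟨f, hfJ, ?_, μ₀, hμ₀, fun μ hμ hμf L hL hw hpos => ?_⟩
  · by_contra! hcon
    have : ∀ v ∈ spanJ J, form P f v = 0 := fun v hv => by
      induction hv using Submodule.span_induction with
      | mem y hy => obtain ⟨j, hj, rfl⟩ := hy; exact hcon j hj
      | zero => simp
      | add y z _ _ hy hz => rw [map_add, hy, hz, add_zero]
      | smul r y _ hy => rw [map_smul, hy, smul_zero]
    exact (form_pos_of_mem_spanJ hfJ hf0).ne' (this f hfJ)
  -- Here `|p μ|² ≤ |f|²` by maximality and `(p μ, f) ≥ x μ f = |f|²` by the projection inequality,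
  -- hence `|p μ - f|² ≤ 0`.
  have hpμ : p μ = f := by
    have h1 := hmax μ hμ
    have h2 := hple μ f hfJ (hpdom μ₀)
    rw [hμf, hpeq μ₀, ← hf] at h2
    have h3 := form_sub_self (P := P) (p μ) f
    by_contra hne
    have h4 := form_pos_of_mem_spanJ (Submodule.sub_mem _ (hpJ μ) hfJ) (sub_ne_zero.2 hne)
    linarith
  have hxf : x μ f = form P f f := by rw [hμf]; exact hpeq μ₀
  set w := wp L with hwdef
  set g := (w⁻¹ : W P).1 f with hg
  have hgJ : g ∈ spanJ J := by
    rw [hg, hwdef, ← wp_reverse]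
    exact wp_mem_span (fun i hi => hL i (List.mem_reverse.1 hi)) hfJ
  have hwg : w.1 g = f := by
    rw [hg, ← LinearEquiv.mul_apply, ← Subgroup.coe_mul, mul_inv_cancel]; rfl
  have hgf : ∀ v, form P g v = form P f (w.1 v) := fun v => by
    rw [← hwg, form_weyl w]
  have hwα : ∀ j ∈ J, w.1 (P.root j) ∈ spanJ J := fun j hj => wp_mem_span hL (root_mem_spanJ hj)
  have hgK : ∀ j ∈ J, form P f (P.root j) = 0 → 0 ≤ form P g (P.root j) := fun j hj h0 => by
    rw [hgf]
    exact (hpos j hj h0).nonneg_of_mem_span (hwα j hj) (form P f) (hpdom μ₀)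
  -- As `w ≠ 1`, some root `j` among the letters becomes negative. By hypothesis `f` is not
  -- orthogonal to it, so `(f, α_j) > 0`, while `(g, α_j) = (f, w α_j) ≤ 0`.
  have hgne : g ≠ f := by
    intro heq
    obtain ⟨j, hj, hjn⟩ := exists_not_isPos hw
    have h1 : 0 < form P f (P.root j) :=
      lt_of_le_of_ne (hpdom μ₀ j (hL j hj)) fun h0 => hjn (hpos j (hL j hj) h0.symm)
    have h2 := ((isPos_or_isPos_neg w j).resolve_left hjn).nonneg_of_mem_span
      (Submodule.neg_mem _ (hwα j (hL j hj))) (form P f) (hpdom μ₀)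
    rw [map_neg, ← hgf, heq] at h2
    linarith
  have hlt : form P f g < form P f f := by
    have h1 := form_pos_of_mem_spanJ (Submodule.sub_mem _ hfJ hgJ) (sub_ne_zero.2 hgne.symm)
    rw [form_sub_self, ← form_weyl w g g, hwg] at h1
    linarith
  -- `N` is large enough for `g + N f` to be dominant; on the walls containing `f` the vector `g` is
  -- already nonnegative. The projection inequality at `g + N f` then gives `x μ g ≤ (f, g) < (f, f)
  -- = x μ f`.
  obtain ⟨N, hN⟩ : ∃ N : ℝ, ∀ j : J,
      -(form P g (P.root (j : Δ.carrier))) / form P f (P.root (j : Δ.carrier)) ≤ N := by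
    obtain ⟨N, hN⟩ := (Set.finite_range fun j : J =>
      -(form P g (P.root (j : Δ.carrier))) / form P f (P.root (j : Δ.carrier))).bddAbove
    exact ⟨N, fun j => hN ⟨j, rfl⟩⟩
  have hle := hple μ (g + N • f) (Submodule.add_mem _ hgJ (Submodule.smul_mem _ _ hfJ))
    (fun j hj => by
      simp only [map_add, map_smul, LinearMap.add_apply, LinearMap.smul_apply, smul_eq_mul]
      by_cases h0 : form P f (P.root j) = 0
      · rw [h0, mul_zero, add_zero]; exact hgK j hj h0
      · have h1 : 0 < form P f (P.root j) := lt_of_le_of_ne (hpdom μ₀ j hj) (Ne.symm h0)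
        have h2 := (div_le_iff₀ h1).1 (hN ⟨j, hj⟩)
        linarith)
  rw [hpμ] at hle
  simp only [map_add, map_smul, smul_eq_mul, hxf] at hle
  rw [hxf]
  intro h
  linarith

/-- Selection for complex valued functionals. -/
theorem exists_selection {Λ : Type*} {Ω : Set Λ} (hΩ : Ω.Finite) (J : Set Δ.carrier)
    (x : Λ → V →ₗ[ℝ] ℂ) (hx : ∃ μ ∈ Ω, ∃ i ∈ J, x μ (P.root i) ≠ 0) :
    ∃ f : V, (∃ j ∈ J, P.coroot' j f ≠ 0) ∧ ∃ μ₀ ∈ Ω, ∀ μ ∈ Ω, x μ f = x μ₀ f →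
      ∀ L : List Δ.carrier, (∀ i ∈ L, i ∈ J) → wp L ≠ 1 →
        (∀ j ∈ J, P.coroot' j f = 0 → IsPos Δ ((wp L : V ≃ₗ[ℝ] V) (P.root j))) →
        x μ (((wp L)⁻¹ : W P).1 f) ≠ x μ f := by
  obtain ⟨μ₁, hμ₁, i, hi, hne⟩ := hx
  -- A single real functional on `ℂ` is enough: values that differ after applying `φ` differ before.
  obtain ⟨φ, hφ⟩ : ∃ φ : ℂ →ₗ[ℝ] ℝ, φ (x μ₁ (P.root i)) ≠ 0 := by
    by_contra! h
    exact hne (Complex.ext (h Complex.reLm) (h Complex.imLm))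
  obtain ⟨ε, -, v, hv, hvd, hpos⟩ :=
    exists_dominant_pos (x := φ ∘ₗ x μ₁) hi (by simpa using hφ)
  obtain ⟨f, -, ⟨j, hj, hjf⟩, μ₀, hμ₀, H⟩ :=
    exists_selection_real hΩ J (fun μ => (ε • φ) ∘ₗ x μ) ⟨μ₁, hμ₁, v, hv, hvd, by simpa using hpos⟩
  refine ⟨f, ⟨j, hj, fun h => hjf ((coroot_eq_zero_iff P f j).1 h)⟩, μ₀, hμ₀,
    fun μ hμ hμf L hL hw hK heq => ?_⟩
  refine H μ hμ (by simp [hμf]) L hL hw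
    (fun j hj h0 => hK j hj ((coroot_eq_zero_iff P f j).2 h0)) ?_
  simp only [LinearMap.comp_apply, heq]

end Selection

end

end GradedHecke

namespace GradedHecke

noncomputable section

set_option linter.unusedSectionVars false

section Modules

variable {I V V' : Type*} [AddCommGroup V] [Module ℝ V] [AddCommGroup V'] [Module ℝ V']
  {P : RootPairing I ℝ V V'} {Δ : SimpleRoots P} (k : Δ.carrier → ℝ)
  {X : Type*} [AddCommGroup X] [Module ℂ X] [Module (Hecke Δ k) X]
  [IsScalarTower ℂ (Hecke Δ k) X]

/-! ### Subspaces stable under a parabolic subalgebra -/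

/-- `U` is stable under `S(V_ℂ)` and the `t_{s_j}`, `j ∈ J`. -/
structure Stable (J : Set Δ.carrier) (U : Submodule ℂ X) : Prop where
  incl_mem : ∀ (a : SymAlg V), ∀ u ∈ U, incl Δ k a • u ∈ U
  refl_mem : ∀ j ∈ J, ∀ u ∈ U, t Δ k (weylRefl P (j : I)) • u ∈ U

/-- The span of the `t_w σ`, `w` a product of fewer than `n` simple reflections from `J`. -/
def wordSpan (J : Set Δ.carrier) (n : ℕ) (σ : Submodule ℂ X) : Submodule ℂ X :=
  Submodule.span ℂ {x | ∃ (L : List Δ.carrier) (y : X), (∀ i ∈ L, i ∈ J) ∧ L.length < n ∧ y ∈ σ ∧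
    x = t Δ k (wp L) • y}

/-- The span of the `t_w σ`, `w` a product of simple reflections from `J`. -/
def stableSpan (J : Set Δ.carrier) (σ : Submodule ℂ X) : Submodule ℂ X :=
  Submodule.span ℂ {x | ∃ (L : List Δ.carrier) (y : X), (∀ i ∈ L, i ∈ J) ∧ y ∈ σ ∧
    x = t Δ k (wp L) • y}

variable {k}

lemma t_cons_smul (i : Δ.carrier) (L : List Δ.carrier) (y : X) :
    t Δ k (wp (i :: L)) • y = t Δ k (weylRefl P (i : I)) • t Δ k (wp L) • y := by
  rw [wp_cons, map_mul, mul_smul]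

lemma incl_smul_t_smul (i : Δ.carrier) (a : SymAlg V) (y : X) :
    incl Δ k a • t Δ k (weylRefl P (i : I)) • y =
      t Δ k (weylRefl P (i : I)) • incl Δ k (act (P.reflection i) a) • y +
        (k i : ℂ) • incl Δ k (diffOp P i a) • y := by
  rw [← mul_smul, incl_mul_t, add_smul, mul_smul, smul_assoc]

lemma Stable.t_mem {J : Set Δ.carrier} {U : Submodule ℂ X} (hU : Stable k J U)
    {L : List Δ.carrier} (hL : ∀ i ∈ L, i ∈ J) {y : X} (hy : y ∈ U) : t Δ k (wp L) • y ∈ U := by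
  induction L with
  | nil => simpa using hy
  | cons i L ih =>
    rw [t_cons_smul]
    exact hU.refl_mem i (hL i List.mem_cons_self) _
      (ih fun j hj => hL j (List.mem_cons_of_mem _ hj))

lemma wordSpan_mono (J : Set Δ.carrier) {m n : ℕ} (h : m ≤ n) (σ : Submodule ℂ X) :
    wordSpan k J m σ ≤ wordSpan k J n σ :=
  Submodule.span_mono fun _ ⟨L, y, h1, h2, h3⟩ => ⟨L, y, h1, h2.trans_le h, h3⟩

lemma refl_smul_mem_wordSpan {J : Set Δ.carrier} {n : ℕ} {σ : Submodule ℂ X} {i : Δ.carrier}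
    (hi : i ∈ J) {x : X} (hx : x ∈ wordSpan k J n σ) :
    t Δ k (weylRefl P (i : I)) • x ∈ wordSpan k J (n + 1) σ := by
  induction hx using Submodule.span_induction with
  | mem x hx =>
    obtain ⟨L, y, hL, hn, hy, rfl⟩ := hx
    refine Submodule.subset_span ⟨i :: L, y, ?_, by simpa using hn, hy, (t_cons_smul i L y).symm⟩
    intro j hj
    rcases List.mem_cons.1 hj with rfl | hj
    · exact hi
    · exact hL j hj
  | zero => rw [smul_zero]; exact Submodule.zero_mem _
  | add x y _ _ hx hy => rw [smul_add]; exact Submodule.add_mem _ hx hy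
  | smul r x _ hx => rw [smul_comm]; exact Submodule.smul_mem _ _ hx

lemma t_smul_mem_wordSpan {J : Set Δ.carrier} {n : ℕ} {σ : Submodule ℂ X} {L : List Δ.carrier}
    (hL : ∀ i ∈ L, i ∈ J) (hn : L.length < n) {y : X} (hy : y ∈ σ) :
    t Δ k (wp L) • y ∈ wordSpan k J n σ :=
  Submodule.subset_span ⟨L, y, hL, hn, hy, rfl⟩

/-- Moving `S(V_ℂ)` past `t_w`, modulo shorter words. -/
lemma incl_smul_word {J : Set Δ.carrier} {σ : Submodule ℂ X}
    (hσ : ∀ (a : SymAlg V), ∀ u ∈ σ, incl Δ k a • u ∈ σ) {L : List Δ.carrier}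
    (hL : ∀ i ∈ L, i ∈ J) (a : SymAlg V) {y : X} (hy : y ∈ σ) :
    incl Δ k a • t Δ k (wp L) • y - t Δ k (wp L) • incl Δ k (act ((wp L)⁻¹ : W P).1 a) • y ∈
      wordSpan k J L.length σ := by
  induction L generalizing a with
  | nil =>
    simp only [wp_nil, inv_one, map_one, one_smul]
    rw [show ((1 : W P) : V ≃ₗ[ℝ] V) = 1 from rfl, act_one, sub_self]
    exact Submodule.zero_mem _
  | cons i L ih =>
    have hL' : ∀ j ∈ L, j ∈ J := fun j hj => hL j (List.mem_cons_of_mem _ hj)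
    have h1 := refl_smul_mem_wordSpan (hL i List.mem_cons_self) (ih hL' (act (P.reflection i) a))
    have h2 := wordSpan_mono J (Nat.le_succ L.length) σ (ih hL' (diffOp P i a))
    have h3 : t Δ k (wp L) • incl Δ k (act ((wp L)⁻¹ : W P).1 (diffOp P i a)) • y ∈
        wordSpan k J (L.length + 1) σ :=
      t_smul_mem_wordSpan hL' (Nat.lt_succ_self _) (hσ _ _ hy)
    have h4 := Submodule.add_mem _ h1 (Submodule.smul_mem _ (k i : ℂ) (Submodule.add_mem _ h2 h3))
    have hact : act ((wp (i :: L))⁻¹ : W P).1 a =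
        act ((wp L)⁻¹ : W P).1 (act (P.reflection i) a) := by
      rw [act_act, wp_cons, mul_inv_rev, weylRefl_inv]; rfl
    rw [hact, t_cons_smul, t_cons_smul, incl_smul_t_smul, List.length_cons]
    convert h4 using 1
    rw [sub_add_cancel, smul_sub]
    abel

lemma mem_stableSpan_of_mem_wordSpan {J : Set Δ.carrier} {n : ℕ} {σ : Submodule ℂ X} {x : X}
    (hx : x ∈ wordSpan k J n σ) : x ∈ stableSpan k J σ := by
  refine Submodule.span_mono ?_ hx
  rintro _ ⟨L, y, h1, _, h2, rfl⟩
  exact ⟨L, y, h1, h2, rfl⟩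

lemma t_smul_mem_stableSpan {J : Set Δ.carrier} {σ : Submodule ℂ X} {L : List Δ.carrier}
    (hL : ∀ i ∈ L, i ∈ J) {y : X} (hy : y ∈ σ) : t Δ k (wp L) • y ∈ stableSpan k J σ :=
  Submodule.subset_span ⟨L, y, hL, hy, rfl⟩

lemma le_stableSpan (J : Set Δ.carrier) (σ : Submodule ℂ X) : σ ≤ stableSpan k J σ := by
  intro y hy
  have := t_smul_mem_stableSpan (k := k) (J := J) (L := []) (by simp) hy
  simpa using this

lemma stableSpan_le {J : Set Δ.carrier} {σ U : Submodule ℂ X} (hU : Stable k J U) (h : σ ≤ U) :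
    stableSpan k J σ ≤ U := by
  refine Submodule.span_le.2 ?_
  rintro _ ⟨L, y, hL, hy, rfl⟩
  exact hU.t_mem hL (h hy)

/-- By `incl_smul_word`, moving `a` past `t_w` leaves `t_w` applied to an element of `σ`, up to
shorter words. -/
lemma stable_stableSpan (J : Set Δ.carrier) {σ : Submodule ℂ X}
    (hσ : ∀ (a : SymAlg V), ∀ u ∈ σ, incl Δ k a • u ∈ σ) : Stable k J (stableSpan k J σ) where
  incl_mem a u hu := by
    induction hu using Submodule.span_induction with
    | mem x hx =>
      obtain ⟨L, y, hL, hy, rfl⟩ := hx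
      have h := mem_stableSpan_of_mem_wordSpan (incl_smul_word hσ hL a hy)
      have h' := t_smul_mem_stableSpan (k := k) hL (hσ (act ((wp L)⁻¹ : W P).1 a) y hy)
      simpa using Submodule.add_mem _ h h'
    | zero => rw [smul_zero]; exact Submodule.zero_mem _
    | add x y _ _ hx hy => rw [smul_add]; exact Submodule.add_mem _ hx hy
    | smul r x _ hx => rw [smul_comm]; exact Submodule.smul_mem _ _ hx
  refl_mem j hj u hu := by
    induction hu using Submodule.span_induction with
    | mem x hx =>
      obtain ⟨L, y, hL, hy, rfl⟩ := hx
      rw [← t_cons_smul]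
      refine t_smul_mem_stableSpan (fun i hi => ?_) hy
      rcases List.mem_cons.1 hi with rfl | hi
      · exact hj
      · exact hL i hi
    | zero => rw [smul_zero]; exact Submodule.zero_mem _
    | add x y _ _ hx hy => rw [smul_add]; exact Submodule.add_mem _ hx hy
    | smul r x _ hx => rw [smul_comm]; exact Submodule.smul_mem _ _ hx

variable (k X) in
/-- The generalized eigenspace of `f ∈ V` for the eigenvalue `c`. -/
def genEig (f : V) (c : ℂ) : Submodule ℂ X :=
  Module.End.maxGenEigenspace (Algebra.lsmul ℂ ℂ X (incl Δ k (ofReal f))) c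

/-- A generalized eigenspace which generates a module is recovered inside that module, provided the
conjugate eigenvalues are different. -/
theorem stableSpan_inf_genEig_le [Finite I] [P.IsReduced] [FiniteDimensional ℂ X]
    {J K : Set Δ.carrier}
    {σ : Submodule ℂ X} (hσ : Stable k K σ) {f : V} {c : ℂ} (hf : σ ≤ genEig k X f c)
    (hinj : ∀ L : List Δ.carrier, (∀ i ∈ L, i ∈ J) → wp L ≠ 1 →
      (∀ j ∈ K, IsPos Δ ((wp L : V ≃ₗ[ℝ] V) (P.root j))) →
      ∀ y ∈ σ, incl Δ k (ofReal (((wp L)⁻¹ : W P).1 f)) • y = c • y → y = 0) :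
    stableSpan k J σ ⊓ genEig k X f c ≤ σ := by
  set T : Module.End ℂ X := Algebra.lsmul ℂ ℂ X (incl Δ k (ofReal f)) - algebraMap ℂ _ c with hT
  have hTx : ∀ x, T x = incl Δ k (ofReal f) • x - c • x := fun x => by simp [hT]
  have hTσ : ∀ y ∈ σ, T y ∈ σ := fun y hy => by
    rw [hTx]
    exact Submodule.sub_mem _ (hσ.incl_mem _ _ hy) (Submodule.smul_mem _ _ hy)
  set M := stableSpan k J σ with hM
  set N : Submodule ℂ X := M.map T ⊔ σ with hN
  -- Modulo `σ`, every element of `M` lies in the image of `T = f - c`. This goes by induction on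
  -- the length of the word.
  have key : ∀ n, ∀ L : List Δ.carrier, L.length = n → (∀ i ∈ L, i ∈ J) → ∀ y ∈ σ,
      t Δ k (wp L) • y ∈ N := by
    intro n
    induction n using Nat.strong_induction_on with
    | _ n ih =>
      intro L hLn hL y hy
      have hshort : wordSpan k J n σ ≤ N := by
        refine Submodule.span_le.2 ?_
        rintro _ ⟨L', y', hL', hlt, hy', rfl⟩
        exact ih _ hlt L' rfl hL' y' hy'
      by_cases hw : wp L = 1
      · rw [hw, map_one, one_smul]
        exact Submodule.mem_sup_right hy
      by_cases hpos : ∀ j ∈ K, IsPos Δ ((wp L : V ≃ₗ[ℝ] V) (P.root j))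
      -- For `w ≠ 1` minimal in its coset `w W_K`, the operator `w⁻¹ f - c` is injective on the
      -- finite dimensional `σ`, hence surjective. With `y = (w⁻¹ f - c) y'`, the vector `T t_w y'`
      -- equals `t_w y` up to shorter words.
      · obtain ⟨y', hy', rfl⟩ : ∃ y' ∈ σ,
            incl Δ k (ofReal (((wp L)⁻¹ : W P).1 f)) • y' - c • y' = y := by
          let S : σ →ₗ[ℂ] σ :=
            ((Algebra.lsmul ℂ ℂ X (incl Δ k (ofReal (((wp L)⁻¹ : W P).1 f))) -
              algebraMap ℂ (Module.End ℂ X) c : Module.End ℂ X)).restrict (p := σ) (q := σ)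
              (fun z hz => Submodule.sub_mem _ (hσ.incl_mem _ _ hz) (Submodule.smul_mem _ _ hz))
          have hS : ∀ z : σ, (S z : X) =
              incl Δ k (ofReal (((wp L)⁻¹ : W P).1 f)) • (z : X) - c • (z : X) := fun z => rfl
          have hSi : Function.Injective S := by
            rw [← LinearMap.ker_eq_bot, LinearMap.ker_eq_bot']
            intro z hz
            have := hS z
            rw [hz] at this
            exact Subtype.ext (hinj L hL hw hpos z z.2 (sub_eq_zero.1 this.symm))
          obtain ⟨z, hz⟩ := LinearMap.injective_iff_surjective.1 hSi ⟨y, hy⟩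
          exact ⟨z, z.2, by rw [← hS, hz]⟩
        have h1 := incl_smul_word hσ.incl_mem hL (ofReal f) hy'
        rw [act_ofReal, hLn] at h1
        have h2 : T (t Δ k (wp L) • y') ∈ N :=
          Submodule.mem_sup_left ⟨_, t_smul_mem_stableSpan hL hy', rfl⟩
        have h3 := Submodule.sub_mem _ h2 (hshort h1)
        rw [hTx] at h3
        convert h3 using 1
        rw [smul_sub, smul_comm _ c]
        abel
      · push Not at hpos
        obtain ⟨j, hj, hjn⟩ := hpos
        -- Here `w` is not minimal in its coset: split off `s_j` with `j ∈ K` on the right and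
        -- absorb it into `σ`.
        obtain ⟨L', hlen, hmem, hw'⟩ := exchange L j hjn
        have h1 : t Δ k (wp L) • y = t Δ k (wp L') • t Δ k (weylRefl P (j : I)) • y := by
          rw [← mul_smul, ← map_mul, hw', mul_assoc, weylRefl_mul_self, mul_one]
        rw [h1]
        exact ih L'.length (by omega) L' rfl (fun i hi => hL i (hmem i hi)) _ (hσ.refl_mem j hj _ hy)
  have hMN : M ≤ N := by
    refine Submodule.span_le.2 ?_
    rintro _ ⟨L, y, hL, hy, rfl⟩
    exact key _ L rfl hL y hy
  have hpow : ∀ m : ℕ, M ≤ M.map (T ^ m) ⊔ σ := by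
    intro m
    induction m with
    | zero =>
      rw [pow_zero, Module.End.one_eq_id, Submodule.map_id]
      exact le_sup_left
    | succ m ih =>
      refine ih.trans (sup_le ?_ le_sup_right)
      rintro _ ⟨x, hx, rfl⟩
      obtain ⟨_, ⟨z, hz, rfl⟩, s, hs, rfl⟩ := Submodule.mem_sup.1 (hMN hx)
      rw [map_add]
      refine Submodule.add_mem _ (Submodule.mem_sup_left ⟨z, hz, by rw [pow_succ]; rfl⟩)
        (Submodule.mem_sup_right ?_)
      clear ih hMN key hx
      induction m with
      | zero => simpa using hs
      | succ m ih => rw [pow_succ', Module.End.mul_apply]; exact hTσ _ ih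
  rintro x ⟨hxM, hxe⟩
  have hgen : ∀ z, z ∈ genEig k X f c ↔ (T ^ Module.finrank ℂ X) z = 0 := by
    intro z
    rw [genEig, Module.End.maxGenEigenspace_eq_genEigenspace_finrank,
      Module.End.mem_genEigenspace_nat, LinearMap.mem_ker, hT, Algebra.algebraMap_eq_smul_one]
  obtain ⟨_, ⟨z, hz, rfl⟩, s, hs, rfl⟩ :=
    Submodule.mem_sup.1 (hpow (Module.finrank ℂ X) hxM)
  have h1 : (T ^ Module.finrank ℂ X) z ∈ genEig k X f c := by
    have := Submodule.sub_mem _ hxe (hf hs)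
    rwa [add_sub_cancel_right] at this
  have h2 : z ∈ genEig k X f c := by
    rw [genEig, Module.End.mem_maxGenEigenspace]
    refine ⟨Module.finrank ℂ X + Module.finrank ℂ X, ?_⟩
    rw [hgen, ← Module.End.mul_apply, ← pow_add] at h1
    rwa [hT, Algebra.algebraMap_eq_smul_one] at h1
  rw [(hgen z).1 h2, zero_add]
  exact hs

end Modules

end

end GradedHecke

namespace GradedHecke

noncomputable section

set_option linter.unusedSectionVars false

section Evaluation

variable {I V V' : Type*} [AddCommGroup V] [Module ℝ V] [AddCommGroup V'] [Module ℝ V']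

/-! ### Evaluation at weights -/

variable (V) in
/-- The inclusion `V → S(V_ℂ)` as a real linear map. -/
def ofRealₗ : V →ₗ[ℝ] SymAlg V where
  toFun := ofReal
  map_add' v w := by simp [ofReal, TensorProduct.tmul_add]
  map_smul' r v := by
    have : (1 : ℂ) ⊗ₜ[ℝ] (r • v) = (r : ℂ) ⊗ₜ[ℝ] v := by
      rw [TensorProduct.tmul_smul, TensorProduct.smul_tmul']; simp
    rw [ofReal, this, ι_tmul]; rfl

lemma ofReal_sub (v w : V) : ofReal (v - w) = ofReal v - ofReal w := map_sub (ofRealₗ V) v w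

lemma ofReal_smul (r : ℝ) (v : V) : ofReal (r • v) = (r : ℂ) • ofReal v :=
  map_smul (ofRealₗ V) r v

variable (P : RootPairing I ℝ V V')

/-- Evaluation at `μ`, restricted to `V`. -/
def evR (μ : Cx V') : V →ₗ[ℝ] ℂ := ((ev P μ).toLinearMap.restrictScalars ℝ) ∘ₗ ofRealₗ V

lemma evR_apply (μ : Cx V') (v : V) : evR P μ v = ev P μ (ofReal v) := rfl

lemma evR_eq (u₁ u₂ : V') (v : V) :
    evR P (1 ⊗ₜ u₁ + Complex.I ⊗ₜ u₂) v =
      (P.toLinearMap v u₁ : ℂ) + Complex.I * (P.toLinearMap v u₂ : ℂ) := by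
  rw [evR_apply, ev, ofReal, SymmetricAlgebra.lift_ι_apply, LinearMap.flip_apply, map_add,
    pairC_tmul, pairC_tmul]
  simp

lemma exists_re_im (μ : Cx V') : ∃ u₁ u₂ : V', μ = 1 ⊗ₜ u₁ + Complex.I ⊗ₜ u₂ := by
  induction μ using TensorProduct.induction_on with
  | zero => exact ⟨0, 0, by simp⟩
  | tmul z u =>
    refine ⟨z.re • u, z.im • u, ?_⟩
    rw [TensorProduct.tmul_smul, TensorProduct.tmul_smul, TensorProduct.smul_tmul',
      TensorProduct.smul_tmul', ← TensorProduct.add_tmul]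
    congr 1
    conv_lhs => rw [← Complex.re_add_im z]
    simp
  | add x y hx hy =>
    obtain ⟨a, b, rfl⟩ := hx
    obtain ⟨a', b', rfl⟩ := hy
    exact ⟨a + a', b + b', by rw [TensorProduct.tmul_add, TensorProduct.tmul_add]; abel⟩

lemma evR_injective {μ ν : Cx V'} (h : ∀ v, evR P μ v = evR P ν v) : μ = ν := by
  obtain ⟨a, b, rfl⟩ := exists_re_im μ
  obtain ⟨a', b', rfl⟩ := exists_re_im ν
  have key : ∀ u u' : V', (∀ v, P.toLinearMap v u = P.toLinearMap v u') → u = u' := fun u u' h =>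
    P.flip.toPerfPair.injective (LinearMap.ext h)
  simp only [evR_eq] at h
  rw [key a a' fun v => by simpa using congrArg Complex.re (h v),
    key b b' fun v => by simpa using congrArg Complex.im (h v)]

lemma exists_evR_eq (g : V →ₗ[ℝ] ℂ) : ∃ μ : Cx V', evR P μ = g := by
  refine ⟨1 ⊗ₜ (P.flip.toPerfPair.symm (Complex.reLm ∘ₗ g)) +
    Complex.I ⊗ₜ (P.flip.toPerfPair.symm (Complex.imLm ∘ₗ g)), LinearMap.ext fun v => ?_⟩
  have key : ∀ φ : V →ₗ[ℝ] ℝ, P.toLinearMap v (P.flip.toPerfPair.symm φ) = φ v := fun φ =>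
    LinearMap.congr_fun (P.flip.toPerfPair.apply_symm_apply φ) v
  rw [evR_eq, key, key, mul_comm]
  exact Complex.re_add_im (g v)

lemma diffOp_ofReal (i : I) (v : V) :
    diffOp P i (ofReal v) = algebraMap ℂ (SymAlg V) (P.coroot' i v : ℝ) := by
  refine diffOp_unique P i ?_
  rw [act_ofReal, P.reflection_apply, ofReal_sub, ofReal_smul, sub_sub_cancel, mul_comm,
    ← Algebra.smul_def]

end Evaluation

/-! ### Weight vectors and generalized eigenspaces -/

section Weights

variable {I V V' : Type*} [AddCommGroup V] [Module ℝ V] [AddCommGroup V'] [Module ℝ V']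
  {P : RootPairing I ℝ V V'} {Δ : SimpleRoots P} (k : Δ.carrier → ℝ)
  {X : Type*} [AddCommGroup X] [Module ℂ X] [Module (Hecke Δ k) X]
  [IsScalarTower ℂ (Hecke Δ k) X]

/-- `x` is an eigenvector of `S(V_ℂ)` of weight `μ`. -/
def IsWt (μ : Cx V') (x : X) : Prop := ∀ a : SymAlg V, incl Δ k a • x = ev P μ a • x

/-- The weights of eigenvectors in `U`. -/
def wts (U : Submodule ℂ X) : Set (Cx V') := {μ | ∃ x ∈ U, x ≠ 0 ∧ IsWt k μ x}

variable {k}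

/-- On a minimal nonzero `S(V_ℂ)`-stable subspace each `a` acts by a scalar, because its eigenspaces
are stable by commutativity. The resulting character is evaluation at a point, as the pairing is
perfect. -/
lemma exists_isWt [FiniteDimensional ℂ X] {U : Submodule ℂ X}
    (hU : ∀ (a : SymAlg V), ∀ u ∈ U, incl Δ k a • u ∈ U) (h0 : U ≠ ⊥) :
    ∃ y ∈ U, y ≠ 0 ∧ ∃ μ : Cx V', IsWt k μ y := by
  let C : Set (Submodule ℂ X) := {S | S ≤ U ∧ S ≠ ⊥ ∧ ∀ (a : SymAlg V), ∀ u ∈ S, incl Δ k a • u ∈ S}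
  obtain ⟨S, ⟨hSU, hS0, hS⟩, hmin⟩ :=
    WellFounded.has_min (wellFounded_lt (α := Submodule ℂ X)) C ⟨U, le_rfl, h0, hU⟩
  have hscal : ∀ a : SymAlg V, ∃ c : ℂ, ∀ y ∈ S, incl Δ k a • y = c • y := by
    intro a
    have : Nontrivial S := Submodule.nontrivial_iff_ne_bot.2 hS0
    obtain ⟨c, hc⟩ := Module.End.exists_eigenvalue
      ((Algebra.lsmul ℂ ℂ X (incl Δ k a)).restrict (hS a))
    obtain ⟨z, hz⟩ := hc.exists_hasEigenvector
    have hz' : incl Δ k a • (z : X) = c • (z : X) := congrArg Subtype.val hz.apply_eq_smul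
    refine ⟨c, ?_⟩
    let S' : Submodule ℂ X :=
      S ⊓ LinearMap.ker (Algebra.lsmul ℂ ℂ X (incl Δ k a) - algebraMap ℂ (Module.End ℂ X) c)
    have hmem : ∀ y, y ∈ S' ↔ y ∈ S ∧ incl Δ k a • y = c • y := fun y => by
      simp [S', sub_eq_zero]
    have hS'C : S' ∈ C := by
      refine ⟨inf_le_left.trans hSU, ?_, fun b u hu => ?_⟩
      · rw [Submodule.ne_bot_iff]
        exact ⟨z, (hmem _).2 ⟨z.2, hz'⟩, fun h => hz.2 (Subtype.ext h)⟩
      · rw [hmem] at hu ⊢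
        refine ⟨hS b u hu.1, ?_⟩
        rw [← mul_smul, ← map_mul, mul_comm, map_mul, mul_smul, hu.2, smul_comm]
    have hS'S : S' = S := by
      by_contra hne
      exact hmin S' hS'C (lt_of_le_of_ne inf_le_left hne)
    intro y hy
    rw [← hS'S] at hy
    exact ((hmem y).1 hy).2
  obtain ⟨y, hyS, hy0⟩ := (Submodule.ne_bot_iff _).1 hS0
  choose χ hχ using hscal
  have hχ' : ∀ a (c : ℂ), incl Δ k a • y = c • y → χ a = c := fun a c h =>
    smul_left_injective ℂ hy0 ((hχ a y hyS).symm.trans h)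
  let g : V →ₗ[ℝ] ℂ :=
    { toFun := fun v => χ (ofReal v)
      map_add' := fun v w => hχ' _ _ (by
        rw [show ofReal (v + w) = ofReal v + ofReal w from map_add (ofRealₗ V) v w, map_add,
          add_smul, hχ _ y hyS, hχ _ y hyS, add_smul])
      map_smul' := fun r v => hχ' _ _ (by
        rw [ofReal_smul, map_smul, smul_assoc, hχ _ y hyS, smul_smul]; rfl) }
  obtain ⟨μ, hμ⟩ := exists_evR_eq P g
  refine ⟨y, hSU hyS, hy0, μ, fun a => ?_⟩
  induction a using SymmetricAlgebra.induction with
  | algebraMap r => rw [AlgHom.commutes, AlgHom.commutes, algebraMap_smul]; rfl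
  | ι x =>
    induction x using TensorProduct.induction_on with
    | zero => simp
    | tmul z v =>
      rw [ι_tmul, map_smul, map_smul, smul_assoc, hχ _ y hyS, smul_smul, smul_eq_mul,
        ← evR_apply, hμ]; rfl
    | add x y hx hy => rw [map_add, map_add, map_add, add_smul, hx, hy, add_smul]
  | mul a b ha hb => rw [map_mul, map_mul, mul_smul, hb, smul_comm, ha, smul_smul, mul_comm]
  | add a b ha hb => rw [map_add, map_add, add_smul, ha, hb, add_smul]

/-- Joint generalized eigenspaces for distinct weights are independent, so in finite dimension only
finitely many are nonzero. -/
lemma finite_wts [FiniteDimensional ℂ X] (U : Submodule ℂ X) : (wts k U).Finite := by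
  have hcomm : ∀ a b : SymAlg V, Commute (Algebra.lsmul ℂ ℂ X (incl Δ k a))
      (Algebra.lsmul ℂ ℂ X (incl Δ k b)) := fun a b => by
    rw [commute_iff_eq, ← map_mul, ← map_mul, ← map_mul, ← map_mul, mul_comm]
  have hind := Module.End.independent_iInf_maxGenEigenspace_of_forall_mapsTo
    (fun a : SymAlg V => Algebra.lsmul ℂ ℂ X (incl Δ k a))
    (fun i j φ => Module.End.mapsTo_maxGenEigenspace_of_comm (hcomm j i) φ)
  have hfin := WellFoundedGT.finite_ne_bot_of_iSupIndep hind
  refine Set.Finite.of_finite_image (f := fun μ a => ev P μ a) (hfin.subset ?_) ?_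
  · rintro _ ⟨μ, ⟨x, -, hx0, hx⟩, rfl⟩
    refine (Submodule.ne_bot_iff _).2 ⟨x, ?_, hx0⟩
    rw [Submodule.mem_iInf]
    intro a
    rw [Module.End.mem_maxGenEigenspace]
    exact ⟨1, by simp [hx a]⟩
  · intro μ _ ν _ h
    exact evR_injective P fun v => congrFun h (ofReal v)

lemma mem_genEig {f : V} {c : ℂ} {x : X} : x ∈ genEig k X f c ↔
    ∃ n : ℕ, ((Algebra.lsmul ℂ ℂ X (incl Δ k (ofReal f)) - c • 1 : Module.End ℂ X) ^ n) x = 0 :=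
  Module.End.mem_maxGenEigenspace _ _ _

lemma IsWt.pow_sub_apply {μ : Cx V'} {x : X} (hx : IsWt k μ x) (a : SymAlg V) (c : ℂ) (n : ℕ) :
    ((Algebra.lsmul ℂ ℂ X (incl Δ k a) - c • 1 : Module.End ℂ X) ^ n) x =
      (ev P μ a - c) ^ n • x := by
  induction n with
  | zero => simp
  | succ n ih =>
    rw [pow_succ', Module.End.mul_apply, ih, map_smul, pow_succ, mul_smul]
    simp [hx a, sub_smul]

lemma IsWt.mem_genEig_iff {μ : Cx V'} {x : X} (hx : IsWt k μ x) (hx0 : x ≠ 0) {f : V} {c : ℂ} :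
    x ∈ genEig k X f c ↔ evR P μ f = c := by
  rw [mem_genEig]
  constructor
  · rintro ⟨n, hn⟩
    rw [hx.pow_sub_apply, smul_eq_zero] at hn
    exact sub_eq_zero.1 (eq_zero_of_pow_eq_zero (hn.resolve_right hx0))
  · rintro h
    exact ⟨1, by rw [hx.pow_sub_apply, ← evR_apply, h]; simp⟩

lemma wts_inf_genEig (U : Submodule ℂ X) (f : V) (c : ℂ) :
    wts k (U ⊓ genEig k X f c) = {μ ∈ wts k U | evR P μ f = c} := by
  ext μ
  constructor
  · rintro ⟨x, ⟨hxU, hxf⟩, hx0, hx⟩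
    exact ⟨⟨x, hxU, hx0, hx⟩, (hx.mem_genEig_iff hx0).1 hxf⟩
  · rintro ⟨⟨x, hxU, hx0, hx⟩, h⟩
    exact ⟨x, ⟨hxU, (hx.mem_genEig_iff hx0).2 h⟩, hx0, hx⟩

lemma smul_mem_genEig {f : V} {c : ℂ} {h : Hecke Δ k} (hc : Commute (incl Δ k (ofReal f)) h) {x : X}
    (hx : x ∈ genEig k X f c) : h • x ∈ genEig k X f c :=
  Module.End.mapsTo_maxGenEigenspace_of_comm (f := Algebra.lsmul ℂ ℂ X (incl Δ k (ofReal f)))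
    (g := Algebra.lsmul ℂ ℂ X h) (hc.map (Algebra.lsmul ℂ ℂ X)) c hx

/-- If the coroot `j` kills `f`, then `s_j f = f` and `Δ_j f = 0`, so `f` commutes with `t_{s_j}`.
-/
lemma Stable.inf_genEig {J K : Set Δ.carrier} {U : Submodule ℂ X} (hU : Stable k J U)
    (hKJ : K ⊆ J) {f : V} (hf : ∀ j ∈ K, P.coroot' j f = 0) (c : ℂ) :
    Stable k K (U ⊓ genEig k X f c) where
  incl_mem a u hu := ⟨hU.incl_mem a u hu.1,
    smul_mem_genEig (by rw [commute_iff_eq, ← map_mul, mul_comm, map_mul]) hu.2⟩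
  refl_mem j hj u hu := by
    refine ⟨hU.refl_mem j (hKJ hj) u hu.1, smul_mem_genEig ?_ hu.2⟩
    rw [commute_iff_eq, incl_mul_t, act_ofReal, P.reflection_apply, hf j hj, diffOp_ofReal, hf j hj]
    simp

/-- A nonzero eigenspace of `g` in `σ` is stable under `S(V_ℂ)`, so it contains a weight vector,
whose weight would take the value `c` at `g`. -/
lemma eq_zero_of_smul_eq [FiniteDimensional ℂ X] {σ : Submodule ℂ X}
    (hσ : ∀ (a : SymAlg V), ∀ u ∈ σ, incl Δ k a • u ∈ σ) {g : V} {c : ℂ}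
    (h : ∀ μ ∈ wts k σ, evR P μ g ≠ c) {y : X} (hy : y ∈ σ) (hyc : incl Δ k (ofReal g) • y = c • y) :
    y = 0 := by
  by_contra hy0
  let S : Submodule ℂ X :=
    σ ⊓ LinearMap.ker (Algebra.lsmul ℂ ℂ X (incl Δ k (ofReal g)) - algebraMap ℂ (Module.End ℂ X) c)
  have hmem : ∀ y, y ∈ S ↔ y ∈ σ ∧ incl Δ k (ofReal g) • y = c • y := fun y => by
    simp [S, sub_eq_zero]
  obtain ⟨z, hz, hz0, μ, hμ⟩ := exists_isWt (U := S) (fun b u hu => by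
    rw [hmem] at hu ⊢
    refine ⟨hσ b u hu.1, ?_⟩
    rw [← mul_smul, ← map_mul, mul_comm, map_mul, mul_smul, hu.2, smul_comm])
    ((Submodule.ne_bot_iff _).2 ⟨y, (hmem y).2 ⟨hy, hyc⟩, hy0⟩)
  rw [hmem] at hz
  exact h μ ⟨z, hz.1, hz0, hμ⟩ (smul_left_injective ℂ hz0 ((hμ _).symm.trans hz.2))

variable {Y : Type*} [AddCommGroup Y] [Module ℂ Y] [Module (Hecke Δ k) Y]
  [IsScalarTower ℂ (Hecke Δ k) Y]

lemma mem_genEig_prod {f : V} {c : ℂ} {x : X} {y : Y} :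
    (x, y) ∈ genEig k (X × Y) f c ↔ x ∈ genEig k X f c ∧ y ∈ genEig k Y f c := by
  have key : ∀ n : ℕ,
      ((Algebra.lsmul ℂ ℂ (X × Y) (incl Δ k (ofReal f)) - c • 1 : Module.End ℂ (X × Y)) ^ n) (x, y) =
      (((Algebra.lsmul ℂ ℂ X (incl Δ k (ofReal f)) - c • 1 : Module.End ℂ X) ^ n) x,
        ((Algebra.lsmul ℂ ℂ Y (incl Δ k (ofReal f)) - c • 1 : Module.End ℂ Y) ^ n) y) := by
    intro n
    induction n with
    | zero => simp
    | succ n ih =>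
      simp only [pow_succ', Module.End.mul_apply, ih]
      simp
  rw [mem_genEig, mem_genEig, mem_genEig]
  constructor
  · rintro ⟨n, hn⟩
    rw [key, Prod.mk_eq_zero] at hn
    exact ⟨⟨n, hn.1⟩, ⟨n, hn.2⟩⟩
  · rintro ⟨⟨m, hm⟩, ⟨n, hn⟩⟩
    refine ⟨m + n, ?_⟩
    rw [key, Prod.mk_eq_zero]
    refine ⟨by rw [add_comm, pow_add, Module.End.mul_apply, hm, map_zero],
      by rw [pow_add, Module.End.mul_apply, hn, map_zero]⟩

lemma isWt_prod {μ : Cx V'} {x : X} {y : Y} :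
    IsWt k μ (x, y) ↔ IsWt k μ x ∧ IsWt k μ y := by
  simp [IsWt, Prod.ext_iff, forall_and]

lemma wts_subset_of_le_prod {U : Submodule ℂ X} {U' : Submodule ℂ Y} {Γ : Submodule ℂ (X × Y)}
    (h : Γ ≤ U.prod U') : wts k Γ ⊆ wts k U ∪ wts k U' := by
  rintro μ ⟨⟨x, y⟩, hxy, hne, hw⟩
  rw [isWt_prod] at hw
  by_cases hx : x = 0
  · refine Or.inr ⟨y, (h hxy).2, fun hy => hne (by rw [hx, hy]; rfl), hw.2⟩
  · exact Or.inl ⟨x, (h hxy).1, hx, hw.1⟩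

end Weights

end

end GradedHecke

namespace GradedHecke

noncomputable section

set_option linter.unusedSectionVars false

section Independence

variable {I V V' : Type*} [AddCommGroup V] [Module ℝ V] [AddCommGroup V'] [Module ℝ V']
  {P : RootPairing I ℝ V V'} {Δ : SimpleRoots P}

/-! ### Reduced words -/

/-- A word in `J` of minimal length among the words with the same product. -/
structure Reduced (J : Set Δ.carrier) (L : List Δ.carrier) : Prop where
  mem : ∀ i ∈ L, i ∈ J
  le : ∀ L' : List Δ.carrier, (∀ i ∈ L', i ∈ J) → wp L' = wp L → L.length ≤ L'.length

lemma exists_reduced {J : Set Δ.carrier} {L : List Δ.carrier} (hL : ∀ i ∈ L, i ∈ J) :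
    ∃ L', Reduced J L' ∧ wp L' = wp L ∧ L'.length ≤ L.length := by
  induction hn : L.length using Nat.strong_induction_on generalizing L with
  | _ n ih =>
    by_cases h : Reduced J L
    · exact ⟨L, h, rfl, hn.le⟩
    · obtain ⟨L', hL', hw, hlt⟩ : ∃ L' : List Δ.carrier, (∀ i ∈ L', i ∈ J) ∧ wp L' = wp L ∧
          L'.length < L.length := by
        by_contra! hcon
        exact h ⟨hL, hcon⟩
      obtain ⟨L'', h1, h2, h3⟩ := ih L'.length (hn ▸ hlt) hL' rfl
      exact ⟨L'', h1, h2.trans hw, h3.trans (hn ▸ hlt.le)⟩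

lemma Reduced.reverse {J : Set Δ.carrier} {L : List Δ.carrier} (h : Reduced J L) :
    Reduced J L.reverse where
  mem i hi := h.mem i (List.mem_reverse.1 hi)
  le L' hL' hw := by
    have := h.le L'.reverse (fun i hi => hL' i (List.mem_reverse.1 hi))
      (by rw [wp_reverse, hw, wp_reverse, inv_inv])
    simpa using this

lemma Reduced.tail {J : Set Δ.carrier} {i : Δ.carrier} {L : List Δ.carrier}
    (h : Reduced J (i :: L)) : Reduced J L where
  mem j hj := h.mem j (List.mem_cons_of_mem _ hj)
  le L' hL' hw := by
    have := h.le (i :: L') (fun j hj => by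
      rcases List.mem_cons.1 hj with rfl | hj
      · exact h.mem _ List.mem_cons_self
      · exact hL' j hj) (by rw [wp_cons, hw, wp_cons])
    simpa using this

variable [Finite I] [P.IsReduced]

/-- Otherwise `exchange` shortens the prefix times the next letter, and the whole word loses two
letters. -/
lemma Reduced.isPos_take {J : Set Δ.carrier} {L : List Δ.carrier} (h : Reduced J L)
    (p : Fin L.length) : IsPos Δ ((wp (L.take p) : V ≃ₗ[ℝ] V) (P.root L[p])) := by
  by_contra hcon
  obtain ⟨L', hlen, hmem, hw⟩ := exchange _ _ hcon
  have h1 := h.le (L' ++ L.drop (p + 1)) (fun i hi => by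
    rcases List.mem_append.1 hi with hi | hi
    · exact h.mem i (List.mem_of_mem_take (hmem i hi))
    · exact h.mem i (List.mem_of_mem_drop hi)) (by
    conv_rhs => rw [← List.take_append_drop p L, ← List.cons_getElem_drop_succ (h := p.2)]
    rw [wp_append, wp_append, wp_cons, hw, mul_assoc]; rfl)
  have h2 := p.2
  simp only [List.length_append, List.length_drop, List.length_take] at h1 hlen
  omega

lemma IsPos.pos_of_mem_span {v : V} (h : IsPos Δ v) (h0 : v ≠ 0) {J : Set Δ.carrier}
    (hv : v ∈ spanJ J) (g : V →ₗ[ℝ] ℝ) (hg : ∀ i ∈ J, 0 < g (P.root i)) : 0 < g v := by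
  classical
  have := Fintype.ofFinite Δ.carrier
  obtain ⟨l, hl⟩ : ∃ l, coord Δ l v ≠ 0 := by
    by_contra! hcon
    refine h0 ?_
    rw [eq_sum_coord h.mem_span]
    exact Finset.sum_eq_zero fun i _ => by rw [hcon, zero_smul]
  have hl' : 0 < coord Δ l v := lt_of_le_of_ne (h.coord_nonneg l) hl.symm
  have hlJ : l ∈ J := by
    by_contra hlJ
    have := h.nonneg_of_mem_span hv (-coord Δ l) (fun i hi => by
      rw [LinearMap.neg_apply, coord_root, if_neg]
      · simp
      · rintro rfl; exact hlJ hi)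
    rw [LinearMap.neg_apply] at this
    linarith
  have h1 := h.nonneg_of_mem_span hv (g - g (P.root l) • coord Δ l) (fun i hi => by
    rw [LinearMap.sub_apply, LinearMap.smul_apply, coord_root]
    split_ifs with hil
    · subst hil; simp
    · simpa using (hg i hi).le)
  rw [LinearMap.sub_apply, LinearMap.smul_apply, smul_eq_mul] at h1
  have := mul_pos (hg l hlJ) hl'
  linarith

lemma weyl_apply_ne_zero (w : W P) (i : I) : (w : V ≃ₗ[ℝ] V) (P.root i) ≠ 0 := by
  rw [Ne, LinearEquiv.map_eq_zero_iff]
  exact P.ne_zero i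

/-- There is a unique element of maximal length in a parabolic subgroup. -/
lemma exists_longest (J : Set Δ.carrier) : ∃ L₀, Reduced J L₀ ∧ ∀ L, Reduced J L →
    wp L ≠ wp L₀ → L.length < L₀.length := by
  have := finite_weyl Δ
  have hbdd : BddAbove {n | ∃ L, Reduced J L ∧ L.length = n} := by
    refine ((Set.finite_range fun w : W P =>
      sInf {n | ∃ L, Reduced J L ∧ wp L = w ∧ L.length = n}).subset ?_).bddAbove
    rintro n ⟨L, hL, rfl⟩
    refine ⟨wp L, ?_⟩
    have : {n | ∃ L', Reduced J L' ∧ wp L' = wp L ∧ L'.length = n} = {L.length} := by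
      ext n
      simp only [Set.mem_ofPred_eq, Set.mem_singleton_iff]
      constructor
      · rintro ⟨L', h1, h2, rfl⟩
        exact le_antisymm (h1.le L hL.mem h2.symm) (hL.le L' h1.mem h2)
      · rintro rfl; exact ⟨L, hL, rfl, rfl⟩
    simp only [this, csInf_singleton]
  have hne : {n | ∃ L : List Δ.carrier, Reduced J L ∧ L.length = n}.Nonempty :=
    ⟨0, [], ⟨by simp, by simp⟩, rfl⟩
  obtain ⟨L₀, hL₀, hlen⟩ := Nat.sSup_mem hne hbdd
  have hle : ∀ L, Reduced J L → L.length ≤ L₀.length := fun L hL => by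
    rw [hlen]; exact le_csSup hbdd ⟨L, hL, rfl⟩
  -- If an element kept the root `j` positive, appending `j` would give a longer reduced word. So
  -- elements of maximal length make every simple root in `J` negative.
  have hneg : ∀ L, Reduced J L → L.length = L₀.length → ∀ j ∈ J,
      ¬ IsPos Δ ((wp L : V ≃ₗ[ℝ] V) (P.root j)) := by
    intro L hL hlL j hj hpos
    have hred : Reduced J (L ++ [j]) := by
      refine ⟨fun i hi => ?_, fun L' hL' hw => ?_⟩
      · rcases List.mem_append.1 hi with hi | hi
        · exact hL.mem i hi
        · rw [List.mem_singleton.1 hi]; exact hj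
      · by_contra! hlt
        have h1 : ¬ IsPos Δ ((wp L' : V ≃ₗ[ℝ] V) (P.root j)) := by
          rw [hw, wp_append, Subgroup.coe_mul, LinearEquiv.mul_apply, wp_cons, wp_nil, mul_one,
            coe_weylRefl, P.reflection_apply_self, map_neg]
          exact fun h => weyl_apply_ne_zero (wp L) j (eq_zero_of_isPos_of_isPos_neg hpos h)
        obtain ⟨L'', h2, h3, h4⟩ := exchange L' j h1
        have := hL.le L'' (fun i hi => hL' i (h3 i hi)) (by
          rw [h4, hw, wp_append, wp_cons, wp_nil, mul_one, mul_assoc, weylRefl_mul_self, mul_one])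
        simp at hlt
        omega
    have := hle _ hred
    simp at this
    omega
  refine ⟨L₀, hL₀, fun L hL hne' => lt_of_le_of_ne (hle L hL) fun heq => hne' ?_⟩
  -- For `w`, `w₀` of maximal length, both `w₀` and `w⁻¹` make the simple roots in `J` negative.
  -- Comparing heights, `w⁻¹ w₀` keeps them positive, so it is trivial.
  have key : wp (L.reverse ++ L₀) = 1 := by
    refine wp_eq_one _ fun j hj => ?_
    have hjJ : j ∈ J := by
      rcases List.mem_append.1 hj with hj | hj
      · exact hL.mem j (List.mem_reverse.1 hj)
      · exact hL₀.mem j hj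
    rw [wp_append, Subgroup.coe_mul, LinearEquiv.mul_apply]
    have h1 := (isPos_or_isPos_neg (wp L₀) j).resolve_left (hneg L₀ hL₀ rfl j hjJ)
    have h2 : (wp L₀ : V ≃ₗ[ℝ] V) (P.root j) ∈ spanJ J :=
      wp_mem_span hL₀.mem (root_mem_spanJ hjJ)
    by_contra hcon
    rw [← LinearEquiv.mul_apply, ← Subgroup.coe_mul] at hcon
    have h3 := (isPos_or_isPos_neg (wp L.reverse * wp L₀) j).resolve_left hcon
    have h4 : (((wp L.reverse * wp L₀ : W P) : V ≃ₗ[ℝ] V) (P.root j)) ∈ spanJ J := by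
      rw [← wp_append]
      exact wp_mem_span (fun i hi => by
        rcases List.mem_append.1 hi with hi | hi
        · exact hL.mem i (List.mem_reverse.1 hi)
        · exact hL₀.mem i hi) (root_mem_spanJ hjJ)
    have h5 := h3.pos_of_mem_span (neg_ne_zero.2 (weyl_apply_ne_zero _ _)) (Submodule.neg_mem _ h4)
      ((∑ᶠ l : Δ.carrier, coord Δ l)) (fun i hi => by
        classical
        have := Fintype.ofFinite Δ.carrier
        rw [finsum_eq_sum_of_fintype]
        simp [coord_root])
    have h6 := h1.nonneg_of_mem_span (Submodule.neg_mem _ h2)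
      (-((∑ᶠ l : Δ.carrier, coord Δ l) ∘ₗ ((wp L.reverse : W P) : V ≃ₗ[ℝ] V).toLinearMap))
      (fun i hi => by
        have h7 := (isPos_or_isPos_neg (wp L.reverse) i).resolve_left
          (hneg _ hL.reverse (by simpa using heq) i hi)
        have h8 := h7.nonneg (∑ᶠ l : Δ.carrier, coord Δ l) (fun l => by
          classical
          have := Fintype.ofFinite Δ.carrier
          rw [finsum_eq_sum_of_fintype]
          simp [coord_root])
        simpa using h8)
    simp only [LinearMap.neg_apply, map_neg, LinearMap.comp_apply, LinearEquiv.coe_coe,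
      Subgroup.coe_mul, LinearEquiv.mul_apply] at h5 h6
    linarith
  rw [wp_append, wp_reverse, inv_mul_eq_one] at key
  exact key

end Independence

end

end GradedHecke

namespace GradedHecke

noncomputable section

set_option linter.unusedSectionVars false

section BaseCase

variable {I V V' : Type*} [AddCommGroup V] [Module ℝ V] [AddCommGroup V'] [Module ℝ V']
  {P : RootPairing I ℝ V V'} {Δ : SimpleRoots P} {k : Δ.carrier → ℝ}
  {X : Type*} [AddCommGroup X] [Module ℂ X] [Module (Hecke Δ k) X]
  [IsScalarTower ℂ (Hecke Δ k) X]

/-! ### Linear independence of the `t_w x` for a weight orthogonal to all coroots in `J` -/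

variable (k X) in
/-- The operator `v - (v, μ)` on `X`. -/
def shiftOp (μ : Cx V') (v : V) : Module.End ℂ X :=
  Algebra.lsmul ℂ ℂ X (incl Δ k (ofReal v)) - algebraMap ℂ _ (evR P μ v)

lemma shiftOp_apply (μ : Cx V') (v : V) (x : X) :
    shiftOp k X μ v x = incl Δ k (ofReal v) • x - evR P μ v • x := by
  simp [shiftOp]

lemma shiftOp_refl {μ : Cx V'} {i : Δ.carrier} (hi : evR P μ (P.root i) = 0) (v : V) (y : X) :
    shiftOp k X μ v (t Δ k (weylRefl P (i : I)) • y) =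
      t Δ k (weylRefl P (i : I)) • shiftOp k X μ (P.reflection i v) y +
        ((k i * P.coroot' i v : ℝ) : ℂ) • y := by
  have h1 : evR P μ (P.reflection i v) = evR P μ v := by
    rw [P.reflection_apply, map_sub, map_smul, hi, smul_zero, sub_zero]
  rw [shiftOp_apply, shiftOp_apply, incl_smul_t_smul, act_ofReal, diffOp_ofReal, h1, smul_sub,
    AlgHom.commutes, algebraMap_smul, smul_comm (evR P μ v), Complex.ofReal_mul,
    mul_smul (k i : ℂ)]
  abel

/-- Since `μ` vanishes on the roots in `J`, `μ` takes the same value at `v` and at its reflections.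
Moving `v - (v, μ)` through the word to the weight vector `x` leaves only the correction terms, each
of which deletes one letter. -/
lemma shiftOp_word {J : Set Δ.carrier} {μ : Cx V'} (hμ : ∀ i ∈ J, evR P μ (P.root i) = 0) {x : X}
    (hx : IsWt k μ x) {L : List Δ.carrier} (hL : ∀ i ∈ L, i ∈ J) (v : V) :
    shiftOp k X μ v (t Δ k (wp L) • x) = ∑ p : Fin L.length,
      ((k L[p] * P.coroot' (L[p] : Δ.carrier) (((wp (L.take p))⁻¹ : W P).1 v) : ℝ) : ℂ) •
        t Δ k (wp (L.eraseIdx p)) • x := by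
  induction L generalizing v with
  | nil => simp [shiftOp_apply, hx (ofReal v), evR_apply]
  | cons i L ih =>
    rw [t_cons_smul, shiftOp_refl (hμ i (hL i List.mem_cons_self)),
      ih fun j hj => hL j (List.mem_cons_of_mem _ hj), add_comm, Finset.smul_sum]
    refine Eq.trans ?_ (Fin.sum_univ_succ (n := L.length) _).symm
    congr 1
    refine Finset.sum_congr rfl fun p _ => ?_
    rw [smul_comm]
    simp only [Fin.val_succ, List.take_succ_cons, List.eraseIdx_cons_succ, wp_cons, map_mul,
      mul_smul, mul_inv_rev, weylRefl_inv, Subgroup.coe_mul, LinearEquiv.mul_apply, coe_weylRefl]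
    rfl

lemma pow_shiftOp_word_eq_zero {J : Set Δ.carrier} {μ : Cx V'}
    (hμ : ∀ i ∈ J, evR P μ (P.root i) = 0) {x : X} (hx : IsWt k μ x) (v : V) (n : ℕ)
    {L : List Δ.carrier} (hL : ∀ i ∈ L, i ∈ J) (hn : L.length < n) :
    (shiftOp k X μ v ^ n) (t Δ k (wp L) • x) = 0 := by
  induction n generalizing L with
  | zero => omega
  | succ n ih =>
    rw [pow_succ, Module.End.mul_apply, shiftOp_word hμ hx hL, map_sum]
    refine Finset.sum_eq_zero fun p _ => ?_
    have hp := p.2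
    rw [map_smul, ih (fun i hi => hL i (List.mem_of_mem_eraseIdx hi)) ?_, smul_zero]
    rw [List.length_eraseIdx_of_lt hp]
    omega

variable [Finite I] [P.IsReduced]

/-- By invariance of the form the sign is that of the pairing of `ρ` with the image of the root
`L[p]` under the prefix, a positive root since `L` is reduced. -/
lemma coroot_take_pos {J : Set Δ.carrier} {ρ : V} (hρ : ∀ i ∈ J, 0 < form P ρ (P.root i))
    {L : List Δ.carrier} (hL : Reduced J L) (p : Fin L.length) :
    0 < P.coroot' (L[p] : Δ.carrier) (((wp (L.take p))⁻¹ : W P).1 ρ) := by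
  rw [coroot_pos_iff, ← form_weyl (wp (L.take p)), ← LinearEquiv.mul_apply]
  have : (wp (L.take p)).1 * ((wp (L.take p))⁻¹ : W P).1 = 1 := by
    rw [← Subgroup.coe_mul, mul_inv_cancel]; rfl
  rw [this]
  exact (hL.isPos_take p).pos_of_mem_span (weyl_apply_ne_zero _ _)
    (wp_mem_span (fun i hi => hL.mem i (List.mem_of_mem_take hi))
      (root_mem_spanJ (hL.mem _ (List.getElem_mem _)))) (form P ρ) hρ

/-- Deleting all letters one by one returns a multiple of `x`. Multiplying by the product of the
`k`'s turns each factor `k` into a square, so all contributions are nonnegative whatever the signs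
of `k`, and nothing cancels. -/
lemma pow_shiftOp_word {J : Set Δ.carrier} {μ : Cx V'} (hk : ∀ i, k i ≠ 0)
    (hμ : ∀ i ∈ J, evR P μ (P.root i) = 0) {x : X} (hx : IsWt k μ x) {ρ : V}
    (hρ : ∀ i ∈ J, 0 < form P ρ (P.root i)) (n : ℕ) {L : List Δ.carrier} (hL : ∀ i ∈ L, i ∈ J)
    (hn : L.length = n) : ∃ c : ℝ, 0 ≤ c ∧ (Reduced J L → 0 < c) ∧
      (((L.map k).prod : ℝ) : ℂ) • (shiftOp k X μ ρ ^ n) (t Δ k (wp L) • x) = (c : ℂ) • x := by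
  induction n generalizing L with
  | zero =>
    rw [List.length_eq_zero_iff] at hn
    subst hn
    exact ⟨1, zero_le_one, fun _ => one_pos, by simp⟩
  | succ n ih =>
    by_cases hred : Reduced J L
    · have hlen : ∀ p : Fin L.length, (L.eraseIdx p).length = n := fun p => by
        rw [List.length_eraseIdx_of_lt p.2]; omega
      choose c hc0 hcpos hc using fun p : Fin L.length =>
        ih (fun i hi => hL i (List.mem_of_mem_eraseIdx hi)) (hlen p)
      have hd := coroot_take_pos hρ hred
      have hterm : ∀ p : Fin L.length, 0 ≤
          k L[p] ^ 2 * P.coroot' (L[p] : Δ.carrier) (((wp (L.take p))⁻¹ : W P).1 ρ) * c p :=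
        fun p => mul_nonneg (mul_nonneg (sq_nonneg _) (hd p).le) (hc0 p)
      refine ⟨∑ p : Fin L.length, k L[p] ^ 2 *
        P.coroot' (L[p] : Δ.carrier) (((wp (L.take p))⁻¹ : W P).1 ρ) * c p,
        Finset.sum_nonneg fun p _ => hterm p, fun _ => ?_, ?_⟩
      -- One strictly positive term is enough: deleting the first letter leaves a reduced word.
      · refine Finset.sum_pos' (fun p _ => hterm p) ⟨⟨0, by omega⟩, Finset.mem_univ _, ?_⟩
        refine mul_pos (mul_pos (by have := hk L[0]; positivity) (hd _)) (hcpos _ ?_)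
        obtain ⟨i, L', rfl⟩ := List.exists_cons_of_length_eq_add_one hn
        exact hred.tail
      · rw [pow_succ, Module.End.mul_apply, shiftOp_word hμ hx hL, map_sum, Finset.smul_sum,
          Complex.ofReal_sum, Finset.sum_smul]
        refine Finset.sum_congr rfl fun p _ => ?_
        have hprod : (L.map k).prod = k L[p] * ((L.eraseIdx p).map k).prod := by
          have := List.CommMonoid.mul_prod_eraseIdx (l := L.map k) (i := p) (by simp)
          rw [← this, List.eraseIdx_map]
          simp
        rw [hprod, map_smul]
        have h1 := congrArg (fun y => ((k L[p] * (k L[p] *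
          P.coroot' (L[p] : Δ.carrier) (((wp (L.take p))⁻¹ : W P).1 ρ)) : ℝ) : ℂ) • y) (hc p)
        simp only [smul_smul] at h1 ⊢
        convert h1 using 2 <;> · push_cast; ring
    · obtain ⟨L', h1, h2, h3⟩ := exists_reduced hL
      refine ⟨0, le_rfl, fun h => absurd h hred, ?_⟩
      have hlt : L'.length < n + 1 := by
        rw [← hn]
        refine lt_of_le_of_ne h3 fun heq => hred ⟨hL, fun L'' h4 h5 => ?_⟩
        rw [← heq]
        exact h1.le L'' h4 (h5.trans h2.symm)
      rw [← h2, pow_shiftOp_word_eq_zero hμ hx ρ (n + 1) h1.mem hlt]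
      simp

/-- Linear independence of the `t_w x`. -/
theorem coeff_eq_zero [Fintype (W P)] {J : Set Δ.carrier} {μ : Cx V'} (hk : ∀ i, k i ≠ 0)
    (hμ : ∀ i ∈ J, evR P μ (P.root i) = 0) {x : X} (hx : IsWt k μ x) (hx0 : x ≠ 0) {c : W P → ℂ}
    (hc : ∀ w, c w ≠ 0 → ∃ L : List Δ.carrier, (∀ i ∈ L, i ∈ J) ∧ wp L = w)
    (hsum : ∑ w, c w • t Δ k w • x = 0) (u : W P) : c u = 0 := by
  by_contra hu
  obtain ⟨ρ, -, hρ⟩ := exists_strictly_dominant (P := P) J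
  obtain ⟨L₀, hL₀, hmax⟩ := exists_longest J
  obtain ⟨U, hU, rfl⟩ := hc _ hu
  obtain ⟨a, -, ha, hax⟩ := pow_shiftOp_word hk hμ hx hρ _ hL₀.mem rfl
  -- Multiplication by `t_{w₀ u⁻¹}` moves the term of `u` to the longest element `w₀` and all others
  -- to shorter ones, which this power of the shift kills.
  have h1 := congrArg (fun y => (shiftOp k X μ ρ ^ L₀.length) (t Δ k (wp L₀ * (wp U)⁻¹) • y)) hsum
  simp only [smul_zero, map_zero, Finset.smul_sum, map_sum] at h1
  rw [Finset.sum_eq_single (wp U)] at h1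
  · rw [smul_comm, map_smul, ← mul_smul, ← map_mul, inv_mul_cancel_right, smul_eq_zero] at h1
    have h2 := h1.resolve_left hu
    rw [h2, smul_zero, eq_comm, smul_eq_zero] at hax
    rcases hax with h | h
    · exact (ha hL₀).ne' (by exact_mod_cast h)
    · exact hx0 h
  · intro w _ hw
    by_cases hcw : c w = 0
    · simp [hcw]
    · obtain ⟨L, hL, rfl⟩ := hc w hcw
      rw [smul_comm, map_smul, ← mul_smul, ← map_mul]
      have hmem : ∀ i ∈ L₀ ++ U.reverse ++ L, i ∈ J := by
        intro i hi
        simp only [List.mem_append, List.mem_reverse] at hi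
        rcases hi with (hi | hi) | hi
        · exact hL₀.mem i hi
        · exact hU i hi
        · exact hL i hi
      obtain ⟨L', h3, h4, -⟩ := exists_reduced hmem
      rw [wp_append, wp_append, wp_reverse] at h4
      rw [← h4, pow_shiftOp_word_eq_zero hμ hx ρ _ h3.mem (hmax L' h3 ?_), smul_zero]
      rw [h4]
      intro heq
      refine hw ?_
      rw [mul_assoc, mul_eq_left, inv_mul_eq_one] at heq
      exact heq.symm
  · simp

end BaseCase

section Graph

variable {I V V' : Type*} [AddCommGroup V] [Module ℝ V] [AddCommGroup V'] [Module ℝ V']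
  {P : RootPairing I ℝ V V'} {Δ : SimpleRoots P} (k : Δ.carrier → ℝ)
  {X : Type*} [AddCommGroup X] [Module ℂ X] [Module (Hecke Δ k) X]
  [IsScalarTower ℂ (Hecke Δ k) X]

/-! ### Simple modules are determined by their weights -/

/-- `U` is a minimal nonzero subspace that is stable under the subalgebra attached to `J`. -/
structure SimpleStable (J : Set Δ.carrier) (U : Submodule ℂ X) : Prop where
  stable : Stable k J U
  ne_bot : U ≠ ⊥
  eq_of_le : ∀ S ≤ U, Stable k J S → S ≠ ⊥ → S = U

variable {Y : Type*} [AddCommGroup Y] [Module ℂ Y] [Module (Hecke Δ k) Y]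
  [IsScalarTower ℂ (Hecke Δ k) Y]

/-- A stable subspace of `U × U'` which is the graph of a bijection when `U`, `U'` are simple. -/
structure IsStableGraph (J : Set Δ.carrier) (U : Submodule ℂ X) (U' : Submodule ℂ Y)
    (Γ : Submodule ℂ (X × Y)) : Prop where
  stable : Stable k J Γ
  le : Γ ≤ U.prod U'
  ne_bot : Γ ≠ ⊥
  comap_inl : Γ.comap (LinearMap.inl ℂ X Y) = ⊥
  comap_inr : Γ.comap (LinearMap.inr ℂ X Y) = ⊥

variable {k}

lemma Stable.prod {J : Set Δ.carrier} {U : Submodule ℂ X} {U' : Submodule ℂ Y} (hU : Stable k J U)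
    (hU' : Stable k J U') : Stable k J (U.prod U') where
  incl_mem a _ hu := ⟨hU.incl_mem a _ hu.1, hU'.incl_mem a _ hu.2⟩
  refl_mem j hj _ hu := ⟨hU.refl_mem j hj _ hu.1, hU'.refl_mem j hj _ hu.2⟩

lemma Stable.comap_inl {J : Set Δ.carrier} {Γ : Submodule ℂ (X × Y)} (h : Stable k J Γ) :
    Stable k J (Γ.comap (LinearMap.inl ℂ X Y)) where
  incl_mem a u hu := by
    have := h.incl_mem a _ hu
    simpa using this
  refl_mem j hj u hu := by
    have := h.refl_mem j hj _ hu
    simpa using this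

lemma Stable.comap_inr {J : Set Δ.carrier} {Γ : Submodule ℂ (X × Y)} (h : Stable k J Γ) :
    Stable k J (Γ.comap (LinearMap.inr ℂ X Y)) where
  incl_mem a u hu := by
    have := h.incl_mem a _ hu
    simpa using this
  refl_mem j hj u hu := by
    have := h.refl_mem j hj _ hu
    simpa using this

/-- To verify that `Γ` is a stable graph it suffices that it does not contain `U` or `U'`. -/
lemma IsStableGraph.of_not_le {J : Set Δ.carrier} {U : Submodule ℂ X} {U' : Submodule ℂ Y}
    (hU : SimpleStable k J U) (hU' : SimpleStable k J U') {Γ : Submodule ℂ (X × Y)}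
    (hΓ : Stable k J Γ) (hle : Γ ≤ U.prod U') (h0 : Γ ≠ ⊥)
    (h1 : ¬ U ≤ Γ.comap (LinearMap.inl ℂ X Y)) (h2 : ¬ U' ≤ Γ.comap (LinearMap.inr ℂ X Y)) :
    IsStableGraph k J U U' Γ where
  stable := hΓ
  le := hle
  ne_bot := h0
  comap_inl := by
    by_contra h
    exact h1 (hU.eq_of_le _ (fun x hx => (hle hx).1) hΓ.comap_inl h).ge
  comap_inr := by
    by_contra h
    exact h2 (hU'.eq_of_le _ (fun x hx => (hle hx).2) hΓ.comap_inr h).ge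

variable [Finite I] [P.IsReduced] [FiniteDimensional ℂ X] [FiniteDimensional ℂ Y]

/-- The graph is generated by the pair `(x, x')` of vectors of weight `μ`. If it contained `(x, 0)`,
the second component would be a relation among the `t_w x'`; all coefficients would vanish, and `x`
with them. The case of `(0, x')` is symmetric. -/
lemma isStableGraph_of_orthogonal (hk : ∀ i, k i ≠ 0) {J : Set Δ.carrier} {U : Submodule ℂ X}
    {U' : Submodule ℂ Y} (hU : SimpleStable k J U) (hU' : SimpleStable k J U')
    {μ : Cx V'} (hμU : μ ∈ wts k U) (hμU' : μ ∈ wts k U') (hμ : ∀ i ∈ J, evR P μ (P.root i) = 0) :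
    ∃ Γ, IsStableGraph k J U U' Γ := by
  have := finite_weyl Δ
  have := Fintype.ofFinite (W P)
  obtain ⟨x, hxU, hx0, hx⟩ := hμU
  obtain ⟨x', hxU', hx0', hx'⟩ := hμU'
  have hxx : IsWt k μ (x, x') := isWt_prod.2 ⟨hx, hx'⟩
  let σ : Submodule ℂ (X × Y) := ℂ ∙ (x, x')
  have hσ : ∀ (a : SymAlg V), ∀ u ∈ σ, incl Δ k a • u ∈ σ := by
    intro a u hu
    obtain ⟨c, rfl⟩ := Submodule.mem_span_singleton.1 hu
    rw [smul_comm, hxx a]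
    exact Submodule.smul_mem _ _ (Submodule.smul_mem _ _ (Submodule.mem_span_singleton_self _))
  have hσU : σ ≤ U.prod U' := by
    rw [Submodule.span_singleton_le_iff_mem]
    exact ⟨hxU, hxU'⟩
  have hmem : ∀ z ∈ stableSpan k J σ, ∃ c : W P → ℂ,
      (∀ w, c w ≠ 0 → ∃ L : List Δ.carrier, (∀ i ∈ L, i ∈ J) ∧ wp L = w) ∧
      z = ∑ w, c w • t Δ k w • (x, x') := by
    classical
    intro z hz
    induction hz using Submodule.span_induction with
    | mem z hz =>
      obtain ⟨L, y, hL, hy, rfl⟩ := hz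
      obtain ⟨d, rfl⟩ := Submodule.mem_span_singleton.1 hy
      refine ⟨Pi.single (wp L) d, fun w hw => ⟨L, hL, ?_⟩, ?_⟩
      · by_contra hne
        exact hw (Pi.single_eq_of_ne (Ne.symm hne) _)
      · rw [Finset.sum_eq_single (wp L)]
        · rw [Pi.single_eq_same, smul_comm]
        · intro w _ hw; rw [Pi.single_eq_of_ne hw, zero_smul]
        · simp
    | zero => exact ⟨0, by simp, by simp⟩
    | add z z' _ _ hz hz' =>
      obtain ⟨c, hc, rfl⟩ := hz
      obtain ⟨c', hc', rfl⟩ := hz'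
      refine ⟨c + c', fun w hw => ?_, by simp only [Pi.add_apply, add_smul, Finset.sum_add_distrib]⟩
      by_cases h : c w = 0
      · exact hc' w fun h' => hw (by simp [h, h'])
      · exact hc w h
    | smul r z _ hz =>
      obtain ⟨c, hc, rfl⟩ := hz
      refine ⟨r • c, fun w hw => hc w fun h => hw (by simp [h]), ?_⟩
      simp [Finset.smul_sum, mul_smul]
  refine ⟨stableSpan k J σ, IsStableGraph.of_not_le hU hU' (stable_stableSpan J hσ)
    (stableSpan_le (hU.stable.prod hU'.stable) hσU) ?_ ?_ ?_⟩
  · rw [Submodule.ne_bot_iff]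
    exact ⟨(x, x'), le_stableSpan J σ (Submodule.mem_span_singleton_self _),
      fun h => hx0 (congrArg Prod.fst h)⟩
  · intro h
    obtain ⟨c, hc, hsum⟩ := hmem _ (h hxU)
    have h1 := coeff_eq_zero hk hμ hx' hx0' hc (by
      have := congrArg Prod.snd hsum
      simpa [Prod.snd_sum] using this.symm)
    have h2 := congrArg Prod.fst hsum
    simp [h1] at h2
    exact hx0 h2
  · intro h
    obtain ⟨c, hc, hsum⟩ := hmem _ (h hxU')
    have h1 := coeff_eq_zero hk hμ hx hx0 hc (by
      have := congrArg Prod.fst hsum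
      simpa [Prod.fst_sum] using this.symm)
    have h2 := congrArg Prod.snd hsum
    simp [h1] at h2
    exact hx0' h2

/-- A suitable generalized eigenspace of a simple module is simple for a smaller parabolic. -/
lemma SimpleStable.inf_genEig {J K : Set Δ.carrier} {U : Submodule ℂ X} (hU : SimpleStable k J U)
    (hKJ : K ⊆ J) {f : V} (hf : ∀ j ∈ K, P.coroot' j f = 0) {c : ℂ}
    (hne : ∃ μ ∈ wts k U, evR P μ f = c)
    (hsel : ∀ μ ∈ wts k U, evR P μ f = c → ∀ L : List Δ.carrier, (∀ i ∈ L, i ∈ J) → wp L ≠ 1 →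
      (∀ j ∈ K, IsPos Δ ((wp L : V ≃ₗ[ℝ] V) (P.root j))) →
      evR P μ (((wp L)⁻¹ : W P).1 f) ≠ c) :
    SimpleStable k K (U ⊓ genEig k X f c) := by
  refine ⟨hU.stable.inf_genEig hKJ hf c, ?_, fun S hS hSs hS0 => ?_⟩
  · obtain ⟨μ, ⟨x, hxU, hx0, hx⟩, hμ⟩ := hne
    exact (Submodule.ne_bot_iff _).2 ⟨x, ⟨hxU, (hx.mem_genEig_iff hx0).2 hμ⟩, hx0⟩
  · refine le_antisymm hS ?_
    -- By simplicity a nonzero `S` generates `U`; the eigenspace in the generated module is then no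
    -- larger than `S`.
    have hspan : stableSpan k J S = U :=
      hU.eq_of_le _ (stableSpan_le hU.stable (hS.trans inf_le_left))
        (stable_stableSpan J hSs.incl_mem)
        fun h => hS0 (le_bot_iff.1 (h ▸ le_stableSpan J S))
    conv_lhs => rw [← hspan]
    refine stableSpan_inf_genEig_le hSs (hS.trans inf_le_right) fun L hL hw1 hpos y hy hyc => ?_
    refine eq_zero_of_smul_eq hSs.incl_mem (fun μ hμ => ?_) hy hyc
    obtain ⟨z, hz, hz0, hzw⟩ := hμ
    have h1 : μ ∈ wts k (U ⊓ genEig k X f c) := ⟨z, hS hz, hz0, hzw⟩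
    rw [wts_inf_genEig] at h1
    exact hsel μ h1.1 h1.2 L hL hw1 hpos

/-- Simple modules with the same weights are isomorphic. -/
theorem exists_isStableGraph (hk : ∀ i, k i ≠ 0) (J : Set Δ.carrier) {U : Submodule ℂ X}
    {U' : Submodule ℂ Y} (hU : SimpleStable k J U) (hU' : SimpleStable k J U')
    (hw : wts k U = wts k U') : ∃ Γ, IsStableGraph k J U U' Γ := by
  induction J using WellFoundedLT.induction generalizing U U' with
  | _ J ih =>
    by_cases hortho : ∃ μ ∈ wts k U, ∃ i ∈ J, evR P μ (P.root i) ≠ 0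
    · obtain ⟨f, ⟨j₀, hj₀, hj₀f⟩, μ₀, hμ₀, hsel⟩ :=
        exists_selection (finite_wts U) J (evR P) hortho
      set c := evR P μ₀ f with hc
      let K : Set Δ.carrier := {j ∈ J | P.coroot' j f = 0}
      have hKJ : K ⊆ J := fun j hj => hj.1
      have hKlt : K < J := lt_of_le_of_ne hKJ fun h => by
        rw [← h] at hj₀; exact hj₀f hj₀.2
      -- The weights of `Z` are weights of `U` or `U'` with value `c` at `f`; as the two sets agree,
      -- the choice of `f` serves the product as well.
      have hinj : ∀ {Z : Submodule ℂ (X × Y)}, Stable k K Z →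
          Z ≤ (U ⊓ genEig k X f c).prod (U' ⊓ genEig k Y f c) →
          stableSpan k J Z ⊓ genEig k (X × Y) f c ≤ Z := by
        intro Z hZ hZle
        refine stableSpan_inf_genEig_le hZ (fun z hz => mem_genEig_prod.2
          ⟨(hZle hz).1.2, (hZle hz).2.2⟩) fun L hL hw1 hpos y hy hyc => ?_
        refine eq_zero_of_smul_eq hZ.incl_mem (fun μ hμ => ?_) hy hyc
        have h1 := wts_subset_of_le_prod hZle hμ
        rw [wts_inf_genEig, wts_inf_genEig, hw, Set.union_self, ← hw] at h1
        rw [← h1.2]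
        exact hsel μ h1.1 h1.2 L hL hw1 fun j hj hjf => hpos j ⟨hj, hjf⟩
      have hsimple : SimpleStable k K (U ⊓ genEig k X f c) :=
        hU.inf_genEig hKJ (fun j hj => hj.2) ⟨μ₀, hμ₀, rfl⟩ fun μ hμ hμf L hL hw1 hpos =>
          hμf ▸ hsel μ hμ hμf L hL hw1 fun j hj hjf => hpos j ⟨hj, hjf⟩
      have hsimple' : SimpleStable k K (U' ⊓ genEig k Y f c) :=
        hU'.inf_genEig hKJ (fun j hj => hj.2) ⟨μ₀, hw ▸ hμ₀, rfl⟩ fun μ hμ hμf L hL hw1 hpos =>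
          hμf ▸ hsel μ (hw ▸ hμ) hμf L hL hw1 fun j hj hjf => hpos j ⟨hj, hjf⟩
      obtain ⟨Γ₀, hΓ₀⟩ := ih K hKlt hsimple hsimple'
        (by rw [wts_inf_genEig, wts_inf_genEig, hw])
      have hle : stableSpan k J Γ₀ ≤ U.prod U' :=
        stableSpan_le (hU.stable.prod hU'.stable)
          (hΓ₀.le.trans (Submodule.prod_mono inf_le_left inf_le_left))
      have htop := hinj hΓ₀.stable hΓ₀.le
      refine ⟨stableSpan k J Γ₀, IsStableGraph.of_not_le hU hU'
        (stable_stableSpan J hΓ₀.stable.incl_mem) hle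
        (fun h => hΓ₀.ne_bot (le_bot_iff.1 (h ▸ le_stableSpan J Γ₀))) (fun h => ?_) fun h => ?_⟩
      -- If the generated module contained `U`, its part in the eigenspace of `f`, which is
      -- contained in `Γ₀`, would contain `(x, 0)` for all `x` in the eigenspace of `U`, against
      -- `Γ₀` being a graph.
      · refine hsimple.ne_bot (le_bot_iff.1 (hΓ₀.comap_inl ▸ fun x hx => ?_))
        exact htop ⟨h hx.1, mem_genEig_prod.2 ⟨hx.2, Submodule.zero_mem _⟩⟩
      · refine hsimple'.ne_bot (le_bot_iff.1 (hΓ₀.comap_inr ▸ fun x hx => ?_))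
        exact htop ⟨h hx.1, mem_genEig_prod.2 ⟨Submodule.zero_mem _, hx.2⟩⟩
    · push Not at hortho
      obtain ⟨y, hy, hy0, μ, hμ⟩ := exists_isWt hU.stable.incl_mem hU.ne_bot
      have hμU : μ ∈ wts k U := ⟨y, hy, hy0, hμ⟩
      exact isStableGraph_of_orthogonal hk hU hU' hμU (hw ▸ hμU) (hortho μ hμU)

end Graph

end

end GradedHecke

namespace GradedHecke

noncomputable section

set_option linter.unusedSectionVars false

section Finiteness

variable {I V V' : Type*} [AddCommGroup V] [Module ℝ V] [AddCommGroup V'] [Module ℝ V']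
  {P : RootPairing I ℝ V V'} {Δ : SimpleRoots P} {k : Δ.carrier → ℝ}
  {X : Type*} [AddCommGroup X] [Module ℂ X] [Module (Hecke Δ k) X]
  [IsScalarTower ℂ (Hecke Δ k) X]

/-! ### Simple modules are finite dimensional -/

section

variable [Finite I] [P.IsReduced]

lemma Stable.smul_mem {U : Submodule ℂ X} (hU : Stable k Set.univ U) (h : Hecke Δ k) {u : X}
    (hu : u ∈ U) : h • u ∈ U := by
  obtain ⟨x, rfl⟩ : ∃ x, GradedHecke.mk Δ k x = h := RingQuot.mkAlgHom_surjective ℂ (Rel Δ k) h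
  induction x using FreeAlgebra.induction generalizing u with
  | grade0 z =>
    rw [AlgHom.commutes, algebraMap_smul]
    exact U.smul_mem z hu
  | grade1 x =>
    rcases x with w | a
    · obtain ⟨L, rfl⟩ := exists_wp_eq Δ w
      exact hU.t_mem (fun _ _ => Set.mem_univ _) hu
    · exact hU.incl_mem a u hu
  | mul x y hx hy => rw [map_mul, mul_smul]; exact hx (hy hu)
  | add x y hx hy => rw [map_add, add_smul]; exact U.add_mem (hx hu) (hy hu)

/-- A stable subspace as a submodule over the Hecke algebra. -/
def Stable.toSubmodule {U : Submodule ℂ X} (hU : Stable k Set.univ U) :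
    Submodule (Hecke Δ k) X where
  carrier := U
  add_mem' := U.add_mem
  zero_mem' := U.zero_mem
  smul_mem' h _ hu := hU.smul_mem h hu

lemma Stable.eq_bot_or_eq_top [IsSimpleModule (Hecke Δ k) X] {U : Submodule ℂ X}
    (hU : Stable k Set.univ U) : U = ⊥ ∨ U = ⊤ := by
  have key {S : Submodule (Hecke Δ k) X} (h : hU.toSubmodule = S) (x : X) : x ∈ U ↔ x ∈ S :=
    SetLike.ext_iff.1 h x
  exact (IsSimpleOrder.eq_bot_or_eq_top hU.toSubmodule).imp (fun h => SetLike.ext (key h))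
    fun h => SetLike.ext (key h)

lemma simpleStable_top [IsSimpleModule (Hecke Δ k) X] :
    SimpleStable k Set.univ (⊤ : Submodule ℂ X) where
  stable := ⟨fun _ _ _ => trivial, fun _ _ _ _ => trivial⟩
  ne_bot := by
    have := IsSimpleModule.nontrivial (Hecke Δ k) X
    have : Nontrivial X := this
    exact top_ne_bot
  eq_of_le S _ hS h0 := hS.eq_bot_or_eq_top.resolve_left h0

/-- `ℍ` is spanned by the `a t_w`. -/
lemma smul_mem_span_t [Module (SymAlg V) X] [IsScalarTower ℂ (SymAlg V) X]
    (hA : ∀ (a : SymAlg V) (x : X), a • x = incl Δ k a • x) (h : Hecke Δ k) (x : X) :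
    h • x ∈ Submodule.span (SymAlg V) (Set.range fun w : W P => t Δ k w • x) := by
  set S := Submodule.span (SymAlg V) (Set.range fun w : W P => t Δ k w • x)
  have hS : Stable k Set.univ (S.restrictScalars ℂ) := by
    refine ⟨fun a u hu => ?_, fun i _ u hu => ?_⟩
    · rw [← hA]; exact S.smul_mem a hu
    · change u ∈ S at hu
      change _ ∈ S
      induction hu using Submodule.span_induction with
      | mem u hu =>
        obtain ⟨w, rfl⟩ := hu
        refine Submodule.subset_span ⟨weylRefl P i * w, ?_⟩
        simp only [map_mul, mul_smul]
      | zero => rw [smul_zero]; exact S.zero_mem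
      | add u v _ _ hu hv => rw [smul_add]; exact S.add_mem hu hv
      | smul a u hu' hu =>
        -- The cross relation for `s_i(a)`, solved for `t_{s_i} a`: it moves `S(V_ℂ)` to the left.
        have h1 := incl_smul_t_smul (k := k) i (act (P.reflection i) a) u
        rw [act_reflection_reflection] at h1
        rw [hA, ← sub_eq_of_eq_add h1, ← hA, ← hA]
        exact S.sub_mem (S.smul_mem _ hu)
          ((S.restrictScalars ℂ).smul_mem _ (S.smul_mem _ hu'))
  refine hS.smul_mem h (Submodule.subset_span ⟨1, ?_⟩)
  simp only [map_one, one_smul]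

end

lemma finiteType_symAlg [FiniteDimensional ℝ V] : Algebra.FiniteType ℂ (SymAlg V) :=
  Algebra.FiniteType.equiv inferInstance
    (SymmetricAlgebra.equivMvPolynomial (Module.finBasis ℂ (Cx V))).symm

/-- Simple `ℍ`-modules are finite dimensional. -/
theorem finiteDimensional_of_isSimpleModule [Finite I] [P.IsReduced] [FiniteDimensional ℝ V]
    [IsSimpleModule (Hecke Δ k) X] : FiniteDimensional ℂ X := by
  have := finite_weyl Δ
  have := finiteType_symAlg (V := V)
  have hX : Nontrivial X := IsSimpleModule.nontrivial (Hecke Δ k) X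
  let _ : Module (SymAlg V) X := Module.compHom X (incl Δ k).toRingHom
  have hA : ∀ (a : SymAlg V) (x : X), a • x = incl Δ k a • x := fun _ _ => rfl
  have : IsScalarTower ℂ (SymAlg V) X := ⟨fun z a x => by
    rw [hA, hA, map_smul, smul_assoc]⟩
  have hfin : Module.Finite (SymAlg V) X := by
    obtain ⟨x, hx⟩ := exists_ne (0 : X)
    refine Module.Finite.of_fg_top ?_
    have h : Submodule.span (SymAlg V) (Set.range fun w : W P => t Δ k w • x) = ⊤ := by
      refine eq_top_iff.2 fun y _ => ?_
      obtain ⟨h, rfl⟩ := IsSimpleModule.toSpanSingleton_surjective (Hecke Δ k) hx y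
      exact smul_mem_span_t hA h x
    rw [← h]
    exact Submodule.fg_span (Set.finite_range _)
  -- `X` is finitely generated over `S(V_ℂ)`, so it has a maximal `S(V_ℂ)`-submodule `M`, and `X ⧸
  -- M` is finite dimensional by the Nullstellensatz.
  obtain ⟨M, hM⟩ := IsCoatomic.exists_coatom (Submodule (SymAlg V) X)
  have hsimple : IsSimpleModule (SymAlg V) (X ⧸ M) := isSimpleModule_iff_isCoatom.2 hM
  obtain ⟨m, hm, ⟨e⟩⟩ := isSimpleModule_iff_quot_maximal.1 hsimple
  let _ : Field (SymAlg V ⧸ m) := Ideal.Quotient.field m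
  have hq : Module.Finite ℂ (SymAlg V ⧸ m) :=
    finite_of_finite_type_of_isJacobsonRing ℂ (SymAlg V ⧸ m)
  have hQ : Module.Finite ℂ (X ⧸ M) := Module.Finite.equiv (e.restrictScalars ℂ).symm
  -- The kernel of `F` consists of the `x` with `ℍ x ⊆ M`. It is a proper `ℍ`-submodule, hence zero,
  -- and `X` embeds in finitely many copies of `X ⧸ M`.
  let F : X →ₗ[ℂ] W P → X ⧸ M := LinearMap.pi fun w =>
    (M.mkQ.restrictScalars ℂ) ∘ₗ (Algebra.lsmul ℂ ℂ X (t Δ k w))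
  have hF : ∀ x, F x = 0 ↔ ∀ h : Hecke Δ k, h • x ∈ M := by
    intro x
    constructor
    · intro hx h
      refine Submodule.span_le.2 ?_ (smul_mem_span_t hA h x)
      rintro _ ⟨w, rfl⟩
      exact (Submodule.Quotient.mk_eq_zero M).1 (congrFun hx w)
    · intro h
      exact funext fun w => (Submodule.Quotient.mk_eq_zero M).2 (h _)
  have hker : Stable k Set.univ (LinearMap.ker F) := by
    refine ⟨fun a u hu => ?_, fun i _ u hu => ?_⟩ <;>
    · rw [LinearMap.mem_ker, hF] at hu ⊢
      intro h
      rw [← mul_smul]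
      exact hu _
  refine Module.Finite.of_injective F (LinearMap.ker_eq_bot.1
    (hker.eq_bot_or_eq_top.resolve_right fun h => hM.1 (eq_top_iff.2 fun x _ => ?_)))
  have := (hF x).1 (LinearMap.mem_ker.1 (h ▸ Submodule.mem_top)) 1
  rwa [one_smul] at this

/-! ### Weights and annihilators -/

/-- The weights are the points where the annihilator vanishes. -/
lemma mem_wts_top_iff [FiniteDimensional ℂ X] {μ : Cx V'} :
    μ ∈ wts k (⊤ : Submodule ℂ X) ↔
      ∀ a : SymAlg V, (∀ x : X, incl Δ k a • x = 0) → ev P μ a = 0 := by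
  constructor
  · rintro ⟨x, -, hx0, hx⟩ a ha
    exact (smul_eq_zero.1 ((hx a).symm.trans (ha x))).resolve_right hx0
  · intro h
    by_contra hμ
    have hfin := finite_wts (⊤ : Submodule ℂ X) (k := k)
    have hsep : ∀ ν ∈ wts k (⊤ : Submodule ℂ X), ∃ v, evR P ν v ≠ evR P μ v := by
      intro ν hν
      by_contra! hv
      exact hμ (evR_injective P hv ▸ hν)
    choose! v hv using hsep
    -- A polynomial vanishing at every weight of `X` but not at `μ`. It has no nonzero eigenvalue on
    -- `X`, so one of its powers annihilates `X`, though that power does not vanish at `μ`.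
    set a : SymAlg V := ∏ ν ∈ hfin.toFinset, (ofReal (v ν) - algebraMap ℂ _ (evR P ν (v ν))) with ha
    have ha0 : ∀ ν ∈ wts k (⊤ : Submodule ℂ X), ev P ν a = 0 := by
      intro ν hν
      rw [ha, map_prod]
      refine Finset.prod_eq_zero (hfin.mem_toFinset.2 hν) ?_
      simp [evR_apply]
    have haμ : ev P μ a ≠ 0 := by
      rw [ha, map_prod]
      refine Finset.prod_ne_zero_iff.2 fun ν hν => ?_
      rw [map_sub, AlgHom.commutes, ← evR_apply]
      exact sub_ne_zero.2 (hv ν (hfin.mem_toFinset.1 hν)).symm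
    set T : Module.End ℂ X := Algebra.lsmul ℂ ℂ X (incl Δ k a) with hT
    have hbot : ∀ c ≠ 0, T.maxGenEigenspace c = ⊥ := by
      intro c hc
      by_contra hne
      obtain ⟨y, hy, hy0, ν, hν⟩ := exists_isWt (k := k) (U := T.maxGenEigenspace c)
        (fun b u hu => Module.End.mapsTo_maxGenEigenspace_of_comm (f := T)
          (g := Algebra.lsmul ℂ ℂ X (incl Δ k b))
          (by rw [commute_iff_eq, hT, ← map_mul, ← map_mul, ← map_mul, ← map_mul, mul_comm]) c hu)
        hne
      obtain ⟨n, hn⟩ := (Module.End.mem_maxGenEigenspace _ _ _).1 hy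
      rw [hν.pow_sub_apply, ha0 ν ⟨y, trivial, hy0, hν⟩, smul_eq_zero] at hn
      exact hc (by simpa using eq_zero_of_pow_eq_zero (hn.resolve_right hy0))
    have htop : T.maxGenEigenspace 0 = ⊤ := by
      rw [eq_top_iff, ← Module.End.iSup_maxGenEigenspace_eq_top T]
      refine iSup_le fun c => ?_
      by_cases hc : c = 0
      · rw [hc]
      · rw [hbot c hc]; exact bot_le
    rw [Module.End.maxGenEigenspace_eq_genEigenspace_finrank] at htop
    have hpow := h (a ^ Module.finrank ℂ X) fun x => by
      have hx : x ∈ T.genEigenspace 0 (Module.finrank ℂ X) := htop ▸ Submodule.mem_top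
      rw [Module.End.mem_genEigenspace_nat, LinearMap.mem_ker, zero_smul, sub_zero, hT, ← map_pow,
        ← map_pow] at hx
      exact hx
    rw [map_pow] at hpow
    exact haμ (eq_zero_of_pow_eq_zero hpow)

/-- A nonzero generalized weight space is stable under `S(V_ℂ)`, so it contains an honest weight
vector, necessarily of the same weight. -/
lemma weights_eq_wts_top [FiniteDimensional ℂ X] :
    weights Δ k X = wts k (⊤ : Submodule ℂ X) := by
  ext μ
  constructor
  · intro h
    obtain ⟨y, hy, hy0, ν, hν⟩ := exists_isWt (k := k) (U := weightSpace Δ k X μ)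
      (fun b u hu => by
        rw [weightSpace, Submodule.mem_iInf] at hu ⊢
        intro a
        exact Module.End.mapsTo_maxGenEigenspace_of_comm
          (f := Algebra.lsmul ℂ ℂ X (incl Δ k a)) (g := Algebra.lsmul ℂ ℂ X (incl Δ k b))
          (by rw [commute_iff_eq, ← map_mul, ← map_mul, ← map_mul, ← map_mul, mul_comm]) _ (hu a))
      h
    have : ν = μ := evR_injective P fun v => by
      obtain ⟨n, hn⟩ := (Module.End.mem_maxGenEigenspace _ _ _).1
        ((Submodule.mem_iInf _).1 hy (ofReal v))
      rw [hν.pow_sub_apply, smul_eq_zero] at hn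
      exact sub_eq_zero.1 (eq_zero_of_pow_eq_zero (hn.resolve_right hy0))
    exact this ▸ ⟨y, trivial, hy0, hν⟩
  · rintro ⟨x, -, hx0, hx⟩
    refine (Submodule.ne_bot_iff _).2 ⟨x, ?_, hx0⟩
    rw [weightSpace, Submodule.mem_iInf]
    exact fun a => (Module.End.mem_maxGenEigenspace _ _ _).2 ⟨1, by simp [hx a]⟩

end Finiteness

end

end GradedHecke

namespace GradedHecke

noncomputable section

set_option linter.unusedSectionVars false

section Conjugation

variable {I V V' : Type*} [AddCommGroup V] [Module ℝ V] [AddCommGroup V'] [Module ℝ V']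

/-! ### Complex conjugation of weights -/

lemma conjCx_conjCx (μ : Cx V') : conjCx V' (conjCx V' μ) = μ := by
  induction μ using TensorProduct.induction_on with
  | zero => simp
  | tmul z u => simp [conjCx]
  | add x y hx hy => rw [map_add, map_add, hx, hy]

lemma evR_conjCx (P : RootPairing I ℝ V V') (μ : Cx V') (v : V) :
    evR P (conjCx V' μ) v = conj (evR P μ v) := by
  obtain ⟨a, b, rfl⟩ := exists_re_im μ
  have h : conjCx V' (1 ⊗ₜ a + Complex.I ⊗ₜ b) = 1 ⊗ₜ a + Complex.I ⊗ₜ (-b) := by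
    simp [conjCx, TensorProduct.neg_tmul, TensorProduct.tmul_neg]
  rw [h, evR_eq, evR_eq]
  simp

lemma ev_conjCx (P : RootPairing I ℝ V V') (μ : Cx V') (a : SymAlg V) :
    ev P (conjCx V' μ) a = conj (ev P μ (conjSym a)) := by
  have : (ev P (conjCx V' μ)).toRingHom =
      (starRingEnd ℂ).comp ((ev P μ).toRingHom.comp conjSym) := by
    refine sym_ringHom_ext (by simp) fun v => ?_
    simpa [evR_apply] using evR_conjCx P μ v
  exact congrArg (fun f : SymAlg V →+* ℂ => f a) this

lemma image_conjCx_eq_of_forall {S T : Set (Cx V')} (h : ∀ μ, μ ∈ T ↔ conjCx V' μ ∈ S) :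
    conjCx V' '' S = T := by
  ext μ
  rw [h]
  constructor
  · rintro ⟨ν, hν, rfl⟩
    rwa [conjCx_conjCx]
  · exact fun hμ => ⟨_, hμ, conjCx_conjCx μ⟩

end Conjugation

section Dual

variable {I V V' : Type*} [AddCommGroup V] [Module ℝ V] [AddCommGroup V'] [Module ℝ V']
  {P : RootPairing I ℝ V V'} {Δ : SimpleRoots P} (k : Δ.carrier → ℝ)
  (X : Type*) [AddCommGroup X] [Module ℂ X] [Module (Hecke Δ k) X]
  [IsScalarTower ℂ (Hecke Δ k) X]

/-! ### The hermitian dual -/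

/-- The hermitian dual: conjugate linear functionals, on which `h` acts by `(hℓ)(x) = ℓ(h^• x)`. -/
def HDual : Type _ := X →ₗ⋆[ℂ] ℂ

instance : AddCommGroup (HDual X) := inferInstanceAs (AddCommGroup (X →ₗ⋆[ℂ] ℂ))

instance : Module ℂ (HDual X) := inferInstanceAs (Module ℂ (X →ₗ⋆[ℂ] ℂ))

instance : FunLike (HDual X) X ℂ := inferInstanceAs (FunLike (X →ₗ⋆[ℂ] ℂ) X ℂ)

instance : AddMonoidHomClass (HDual X) X ℂ :=
  inferInstanceAs (AddMonoidHomClass (X →ₗ⋆[ℂ] ℂ) X ℂ)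

variable {k X}

instance : Module (Hecke Δ k) (HDual X) where
  smul h ℓ := (LinearMap.comp (ℓ : X →ₗ⋆[ℂ] ℂ) (Algebra.lsmul ℂ ℂ X (bullet Δ k h) : X →ₗ[ℂ] X) :
    X →ₗ⋆[ℂ] ℂ)
  one_smul ℓ := LinearMap.ext fun x => congrArg (ℓ : X →ₗ⋆[ℂ] ℂ)
    (by simp [bullet] : bullet Δ k 1 • x = x)
  mul_smul h h' ℓ := LinearMap.ext fun x => congrArg (ℓ : X →ₗ⋆[ℂ] ℂ)
    (by simp [mul_smul] : bullet Δ k (h * h') • x = bullet Δ k h' • bullet Δ k h • x)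
  smul_zero _ := LinearMap.ext fun _ => rfl
  smul_add _ _ _ := LinearMap.ext fun _ => rfl
  add_smul h h' ℓ := LinearMap.ext fun x => (congrArg (ℓ : X →ₗ⋆[ℂ] ℂ)
    (by simp [add_smul] : bullet Δ k (h + h') • x = bullet Δ k h • x + bullet Δ k h' • x)).trans
      (map_add ℓ _ _)
  zero_smul ℓ := LinearMap.ext fun x => (congrArg (ℓ : X →ₗ⋆[ℂ] ℂ)
    (by simp [bullet] : bullet Δ k 0 • x = 0)).trans (map_zero ℓ)

lemma HDual.hecke_smul_apply (h : Hecke Δ k) (ℓ : HDual X) (x : X) :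
    (h • ℓ) x = ℓ (bullet Δ k h • x) := rfl

lemma HDual.smul_apply (z : ℂ) (ℓ : HDual X) (x : X) : (z • ℓ) x = z * ℓ x := rfl

lemma HDual.map_smul (ℓ : HDual X) (z : ℂ) (x : X) : ℓ (z • x) = conj z * ℓ x :=
  LinearMap.map_smulₛₗ (ℓ : X →ₗ⋆[ℂ] ℂ) z x

lemma HDual.ext {ℓ ℓ' : HDual X} (h : ∀ x, ℓ x = ℓ' x) : ℓ = ℓ' := DFunLike.ext _ _ h

instance : IsScalarTower ℂ (Hecke Δ k) (HDual X) := ⟨fun z h ℓ => HDual.ext fun x => by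
  rw [HDual.smul_apply, HDual.hecke_smul_apply, HDual.hecke_smul_apply, bullet_smul, smul_assoc,
    HDual.map_smul, Complex.conj_conj]⟩

/-- The conjugate linear identification of the hermitian dual with the dual. -/
def HDual.toDual : HDual X ≃ₗ⋆[ℂ] Module.Dual ℂ X where
  toFun ℓ :=
    { toFun := fun x => conj (ℓ x)
      map_add' := fun x y => by
        rw [map_add, map_add]
      map_smul' := fun z x => by simp [HDual.map_smul] }
  invFun φ := (
    { toFun := fun x => conj (φ x)
      map_add' := fun x y => by simp
      map_smul' := fun z x => by simp } : X →ₗ⋆[ℂ] ℂ)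
  map_add' ℓ ℓ' := LinearMap.ext fun x => map_add (starRingEnd ℂ) (ℓ x) (ℓ' x)
  map_smul' z ℓ := LinearMap.ext fun x => map_mul (starRingEnd ℂ) z (ℓ x)
  left_inv ℓ := HDual.ext fun x => Complex.conj_conj (ℓ x)
  right_inv φ := LinearMap.ext fun x => Complex.conj_conj (φ x)

lemma HDual.toDual_apply (ℓ : HDual X) (x : X) : HDual.toDual ℓ x = conj (ℓ x) := rfl

variable [FiniteDimensional ℂ X]

instance : FiniteDimensional ℂ (HDual X) := by
  let b := Module.finBasis ℂ X
  let F : HDual X →ₗ[ℂ] (Fin (Module.finrank ℂ X) → ℂ) :=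
    { toFun := fun ℓ i => ℓ (b i)
      map_add' := fun _ _ => rfl
      map_smul' := fun _ _ => rfl }
  refine Module.Finite.of_injective F fun ℓ ℓ' h => ?_
  exact (b.ext fun i => congrFun h i : (ℓ : X →ₗ⋆[ℂ] ℂ) = ℓ')

/-- A subspace of the hermitian dual with trivial common kernel is everything. -/
lemma HDual.eq_top {U : Submodule ℂ (HDual X)} (h : ∀ x : X, (∀ ℓ ∈ U, ℓ x = 0) → x = 0) :
    U = ⊤ := by
  set D : Submodule ℂ (Module.Dual ℂ X) := U.map (HDual.toDual : HDual X ≃ₗ⋆[ℂ] _).toLinearMap with hD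
  have h1 : D.dualCoannihilator = ⊥ := by
    rw [eq_bot_iff]
    intro x hx
    refine h x fun ℓ hℓ => ?_
    have := (Submodule.mem_dualCoannihilator x).1 hx _ (Submodule.mem_map_of_mem hℓ)
    exact (map_eq_zero (starRingEnd ℂ)).1 this
  have h2 : D = ⊤ := by
    rw [← Subspace.dualCoannihilator_dualAnnihilator_eq (W := D), h1,
      Submodule.dualAnnihilator_bot]
  rw [eq_top_iff]
  intro ℓ _
  have h3 : HDual.toDual ℓ ∈ D := h2 ▸ Submodule.mem_top
  obtain ⟨ℓ', hℓ', h4⟩ := h3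
  rwa [← HDual.toDual.injective h4]

/-- The common kernel of a stable `S` is stable in `X`, hence `0` or `X`; by duality `S` is
everything or zero. -/
lemma simpleStable_hDual [Finite I] [P.IsReduced] [IsSimpleModule (Hecke Δ k) X] :
    SimpleStable k Set.univ (⊤ : Submodule ℂ (HDual X)) where
  stable := ⟨fun _ _ _ => trivial, fun _ _ _ _ => trivial⟩
  ne_bot := by
    have : Nontrivial X := IsSimpleModule.nontrivial (Hecke Δ k) X
    have : Nontrivial (HDual X) := HDual.toDual.toEquiv.nontrivial
    exact top_ne_bot
  eq_of_le S _ hS h0 := by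
    let N : Submodule ℂ X :=
      { carrier := {x | ∀ ℓ ∈ S, ℓ x = 0}
        add_mem' := fun hx hy ℓ hℓ => by rw [map_add, hx ℓ hℓ, hy ℓ hℓ, add_zero]
        zero_mem' := fun ℓ _ => map_zero ℓ
        smul_mem' := fun z x hx ℓ hℓ => by rw [HDual.map_smul, hx ℓ hℓ, mul_zero] }
    have hN : Stable k Set.univ N := by
      refine ⟨fun a u hu ℓ hℓ => ?_, fun i _ u hu ℓ hℓ => ?_⟩
      · have := hu _ (hS.incl_mem (conjSym a) ℓ hℓ)
        rwa [HDual.hecke_smul_apply, bullet_incl, conjSym_conjSym] at this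
      · have := hu _ (hS.refl_mem i (Set.mem_univ _) ℓ hℓ)
        rwa [HDual.hecke_smul_apply, bullet_t, weylRefl_inv] at this
    refine HDual.eq_top fun x hx => ?_
    refine (Submodule.eq_bot_iff N).1 (hN.eq_bot_or_eq_top.resolve_right fun h => h0 ?_) x hx
    rw [eq_bot_iff]
    intro ℓ hℓ
    refine HDual.ext fun x => ?_
    have hx : x ∈ N := h ▸ Submodule.mem_top
    exact hx ℓ hℓ

/-- An element `a` kills the dual exactly when `conjSym a` kills `X`, and the weights are determined
by annihilators. -/
lemma mem_wts_hDual_iff {μ : Cx V'} : μ ∈ wts k (⊤ : Submodule ℂ (HDual X)) ↔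
    conjCx V' μ ∈ wts k (⊤ : Submodule ℂ X) := by
  have hann : ∀ a : SymAlg V, (∀ ℓ : HDual X, incl Δ k a • ℓ = 0) ↔
      ∀ x : X, incl Δ k (conjSym a) • x = 0 := by
    intro a
    constructor
    · intro h x
      refine (Module.forall_dual_apply_eq_zero_iff ℂ _).1 fun φ => ?_
      obtain ⟨ℓ, rfl⟩ := HDual.toDual.surjective φ
      have := congrArg (fun ℓ' : HDual X => ℓ' x) (h ℓ)
      simp only [HDual.hecke_smul_apply, bullet_incl] at this
      rw [HDual.toDual_apply, this]
      exact map_zero _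
    · intro h ℓ
      refine HDual.ext fun x => ?_
      rw [HDual.hecke_smul_apply, bullet_incl, h]
      exact map_zero ℓ
  rw [mem_wts_top_iff, mem_wts_top_iff]
  constructor
  · intro h a ha
    rw [ev_conjCx, h _ ((hann _).2 (by rwa [conjSym_conjSym])), map_zero]
  · intro h a ha
    have := h _ ((hann a).1 ha)
    rwa [ev_conjCx, conjSym_conjSym, map_eq_zero] at this

end Dual

section Forms

variable {I V V' : Type*} [AddCommGroup V] [Module ℝ V] [AddCommGroup V'] [Module ℝ V']
  {P : RootPairing I ℝ V V'} {Δ : SimpleRoots P} {k : Δ.carrier → ℝ}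
  {X : Type*} [AddCommGroup X] [Module ℂ X] [Module (Hecke Δ k) X]
  [IsScalarTower ℂ (Hecke Δ k) X]

/-! ### Invariant forms -/

/-- The hermitian form `z B(x, y) + conj (z B(y, x))`. -/
def hermitianPart (B : X →ₗ[ℂ] X →ₗ⋆[ℂ] ℂ) (z : ℂ) : X →ₗ[ℂ] X →ₗ⋆[ℂ] ℂ :=
  LinearMap.mk₂'ₛₗ (RingHom.id ℂ) (starRingEnd ℂ) (fun x y => z * B x y + conj (z * B y x))
    (fun x x' y => by simp only [map_add, LinearMap.add_apply, mul_add]; abel)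
    (fun c x y => by
      simp only [map_smul, map_smulₛₗ, LinearMap.smul_apply, smul_eq_mul, map_mul,
        Complex.conj_conj, RingHom.id_apply]
      ring)
    (fun x y y' => by simp only [map_add, LinearMap.add_apply, mul_add]; abel)
    (fun c x y => by
      simp only [map_smul, map_smulₛₗ, LinearMap.smul_apply, smul_eq_mul, map_mul]
      ring)

lemma hermitianPart_apply (B : X →ₗ[ℂ] X →ₗ⋆[ℂ] ℂ) (z : ℂ) (x y : X) :
    hermitianPart B z x y = z * B x y + conj (z * B y x) := rfl

lemma isInvariantHermitian_hermitianPart {B : X →ₗ[ℂ] X →ₗ⋆[ℂ] ℂ}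
    (hB : ∀ (h : Hecke Δ k) (x y : X), B (h • x) y = B x (bullet Δ k h • y)) (z : ℂ) :
    IsInvariantHermitian Δ k X (hermitianPart B z) where
  hermitian x y := by
    rw [hermitianPart_apply, hermitianPart_apply, map_add, Complex.conj_conj, add_comm]
  invariant h x y := by
    rw [hermitianPart_apply, hermitianPart_apply, hB, hB, bullet_bullet]

variable [Finite I] [P.IsReduced] [IsSimpleModule (Hecke Δ k) X]

lemma IsInvariantHermitian.nondegenerate {B : X →ₗ[ℂ] X →ₗ⋆[ℂ] ℂ}
    (hB : IsInvariantHermitian Δ k X B) (h0 : B ≠ 0) (x : X) (hx : ∀ y, B x y = 0) : x = 0 := by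
  have hstab : Stable k Set.univ (LinearMap.ker B) := by
    refine ⟨fun a u hu => ?_, fun i _ u hu => ?_⟩ <;>
    · rw [LinearMap.mem_ker] at hu ⊢
      ext y
      rw [hB.invariant, hu]
      rfl
  have hbot := hstab.eq_bot_or_eq_top.resolve_right fun h => h0 (LinearMap.ker_eq_top.1 h)
  exact (Submodule.eq_bot_iff _).1 hbot x (LinearMap.mem_ker.2 (LinearMap.ext hx))

/-- The hermitian parts of `B` and `i B` cannot both vanish unless `B` does, and by simplicity a
nonzero invariant hermitian form is nondegenerate. -/
lemma admitsBulletForm_of_ne_zero {B : X →ₗ[ℂ] X →ₗ⋆[ℂ] ℂ}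
    (hB : ∀ (h : Hecke Δ k) (x y : X), B (h • x) y = B x (bullet Δ k h • y)) (h0 : B ≠ 0) :
    AdmitsBulletForm Δ k X := by
  have key : ∀ z, hermitianPart B z ≠ 0 → AdmitsBulletForm Δ k X := fun z hz =>
    ⟨_, isInvariantHermitian_hermitianPart hB z,
      (isInvariantHermitian_hermitianPart hB z).nondegenerate hz⟩
  by_contra hno
  have h1 : hermitianPart B 1 = 0 := by_contra fun h => hno (key _ h)
  have h2 : hermitianPart B Complex.I = 0 := by_contra fun h => hno (key _ h)
  refine h0 (LinearMap.ext fun x => LinearMap.ext fun y => ?_)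
  have e1 := hermitianPart_apply B 1 x y
  have e2 := hermitianPart_apply B Complex.I x y
  rw [h1] at e1
  rw [h2] at e2
  simp only [LinearMap.zero_apply, map_mul, Complex.conj_I, one_mul] at e1 e2 ⊢
  have h3 : Complex.I * (2 * B x y) = 0 := by linear_combination -Complex.I * e1 - e2
  simpa using h3

/-- `X` and its hermitian dual have the same weights, so there is a stable graph `Γ` between them.
It is the graph of an `ℍ`-map `g`, and the form is `B(x, y) = g(x)(y)`. -/
lemma admitsBulletForm_of_image_eq [FiniteDimensional ℂ X] (hk : ∀ i, k i ≠ 0)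
    (h : conjCx V' '' weights Δ k X = weights Δ k X) : AdmitsBulletForm Δ k X := by
  rw [weights_eq_wts_top, image_conjCx_eq_of_forall fun μ => mem_wts_hDual_iff] at h
  obtain ⟨Γ, hΓ⟩ := exists_isStableGraph hk Set.univ (simpleStable_top (X := X) (k := k))
    (simpleStable_hDual (X := X) (k := k)) h.symm
  let p : Γ →ₗ[ℂ] X := LinearMap.fst ℂ X (HDual X) ∘ₗ Γ.subtype
  let q : Γ →ₗ[ℂ] HDual X := LinearMap.snd ℂ X (HDual X) ∘ₗ Γ.subtype
  have hp : Function.Injective p := by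
    rw [← LinearMap.ker_eq_bot, LinearMap.ker_eq_bot']
    rintro ⟨⟨x, ℓ⟩, hm⟩ hx
    obtain rfl : x = 0 := hx
    have : ℓ ∈ Γ.comap (LinearMap.inr ℂ X (HDual X)) := hm
    rw [hΓ.comap_inr, Submodule.mem_bot] at this
    subst this
    rfl
  have hp' : Function.Surjective p := by
    have hst : Stable k Set.univ (LinearMap.range p) := by
      constructor
      · rintro a _ ⟨γ, rfl⟩
        exact ⟨⟨_, hΓ.stable.incl_mem a _ γ.2⟩, rfl⟩
      · rintro i hi _ ⟨γ, rfl⟩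
        exact ⟨⟨_, hΓ.stable.refl_mem i hi _ γ.2⟩, rfl⟩
    refine LinearMap.range_eq_top.1 (hst.eq_bot_or_eq_top.resolve_left fun hbot => hΓ.ne_bot ?_)
    rw [eq_bot_iff]
    intro γ hγ
    have h0 : p ⟨γ, hγ⟩ = p 0 := by
      rw [map_zero, LinearMap.range_eq_bot.1 hbot, LinearMap.zero_apply]
    exact congrArg Subtype.val (hp h0)
  let e := LinearEquiv.ofBijective p ⟨hp, hp'⟩
  let g : X →ₗ[ℂ] HDual X := q ∘ₗ e.symm.toLinearMap
  have hg : ∀ γ : Γ, g γ.1.1 = γ.1.2 := fun γ => by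
    change q (e.symm (e γ)) = _
    rw [e.symm_apply_apply]
    rfl
  have hg' : ∀ x, (x, g x) ∈ Γ := fun x => by
    obtain ⟨γ, rfl⟩ := hp' x
    rw [show g (p γ) = γ.1.2 from hg γ]
    exact γ.2
  have hgh : ∀ (h : Hecke Δ k) x, g (h • x) = h • g x := fun h x =>
    hg ⟨_, hΓ.stable.smul_mem h (hg' x)⟩
  refine admitsBulletForm_of_ne_zero (B := (g : X →ₗ[ℂ] X →ₗ⋆[ℂ] ℂ)) (fun h x y => ?_) fun h0 => ?_
  · exact congrArg (fun ℓ : HDual X => ℓ y) (hgh h x)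
  · have : Nontrivial X := IsSimpleModule.nontrivial (Hecke Δ k) X
    obtain ⟨x, hx⟩ := exists_ne (0 : X)
    have hx' := hg' x
    rw [show g x = 0 from LinearMap.congr_fun h0 x] at hx'
    have : x ∈ Γ.comap (LinearMap.inl ℂ X (HDual X)) := hx'
    rw [hΓ.comap_inl] at this
    exact hx this

/-- By invariance and nondegeneracy, `conjSym a` kills `X` whenever `a` does, so the zeros of the
annihilator are closed under conjugation. -/
lemma image_eq_of_admitsBulletForm [FiniteDimensional ℂ X] (h : AdmitsBulletForm Δ k X) :
    conjCx V' '' weights Δ k X = weights Δ k X := by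
  obtain ⟨B, hB, hnd⟩ := h
  have key : ∀ μ ∈ wts k (⊤ : Submodule ℂ X), conjCx V' μ ∈ wts k (⊤ : Submodule ℂ X) := by
    intro μ hμ
    rw [mem_wts_top_iff] at hμ ⊢
    intro a ha
    rw [ev_conjCx, hμ (conjSym a) fun x => hnd _ fun y => ?_, map_zero]
    rw [hB.invariant, bullet_incl, conjSym_conjSym, ha, map_zero]
  rw [weights_eq_wts_top]
  refine image_conjCx_eq_of_forall fun μ => ⟨key μ, fun h => ?_⟩
  rw [← conjCx_conjCx μ]
  exact key _ h

/-- The weights of a module with real central character are real. -/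
lemma image_eq_of_hasRealCentralCharacter [FiniteDimensional ℂ X]
    (h : HasRealCentralCharacter Δ k X) : conjCx V' '' weights Δ k X = weights Δ k X := by
  obtain ⟨u, hu⟩ := h
  have := finite_weyl Δ
  have := Fintype.ofFinite (W P)
  have hreal : ∀ μ ∈ weights Δ k X, conjCx V' μ = μ := by
    intro μ hμ
    rw [weights_eq_wts_top] at hμ
    obtain ⟨x, -, hx0, hx⟩ := hμ
    refine evR_injective P fun v => ?_
    rw [evR_conjCx]
    set z := evR P μ v with hz
    -- This `W`-invariant vanishes at `μ` through the factor `w = 1`. Its value at `u` is the same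
    -- scalar on `X`, so some factor vanishes there: `z = (w v, u)`, which is real.
    set a : SymAlg V := ∏ w : W P, (algebraMap ℂ _ z - ofReal (w.1 v)) with ha
    have hinv : ∀ w : W P, act (w : V ≃ₗ[ℝ] V) a = a := by
      intro w
      rw [ha, map_prod]
      refine Fintype.prod_equiv (Equiv.mulLeft w) _ _ fun w' => ?_
      rw [map_sub, AlgHom.commutes, act_ofReal]
      rfl
    have h1 : ev P μ a = 0 := by
      rw [ha, map_prod]
      refine Finset.prod_eq_zero (Finset.mem_univ 1) ?_
      rw [map_sub, AlgHom.commutes, ← evR_apply]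
      exact sub_self z
    have h2 : ev P (1 ⊗ₜ u) a = 0 := by
      have := (hu a hinv x).symm.trans (hx a)
      rw [h1, zero_smul] at this
      exact (smul_eq_zero.1 this).resolve_right hx0
    rw [ha, map_prod, Finset.prod_eq_zero_iff] at h2
    obtain ⟨w, -, hw⟩ := h2
    rw [map_sub, AlgHom.commutes, ev_ofReal, sub_eq_zero] at hw
    rw [show z = _ from hw]
    exact Complex.conj_ofReal _
  rw [Set.image_congr hreal, Set.image_id']

end Forms

end

end GradedHecke

/-! ### The main theorem -/

open GradedHecke in
theorem corollaryc {I V V' : Type*} [Finite I]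
    [AddCommGroup V] [Module ℝ V] [FiniteDimensional ℝ V] [AddCommGroup V'] [Module ℝ V']
    [FiniteDimensional ℝ V'] (P : RootPairing I ℝ V V') [P.IsReduced] (Δ : SimpleRoots P)
    (k : Δ.carrier → ℝ)
    (hkW : ∀ i j : Δ.carrier, (∃ w ∈ W P, w (P.root i) = P.root j) → k i = k j)
    (hk0 : ∀ i, k i ≠ 0)
    (X : Type*) [AddCommGroup X] [Module ℂ X] [Module (Hecke Δ k) X]
    [IsScalarTower ℂ (Hecke Δ k) X] [IsSimpleModule (Hecke Δ k) X] :
    (AdmitsBulletForm Δ k X ↔ conjCx V' '' weights Δ k X = weights Δ k X) ∧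
      (HasRealCentralCharacter Δ k X → AdmitsBulletForm Δ k X) := by
  have := finiteDimensional_of_isSimpleModule (k := k) (X := X)
  exact ⟨⟨image_eq_of_admitsBulletForm, admitsBulletForm_of_image_eq hk0⟩,
    fun h => admitsBulletForm_of_image_eq hk0 (image_eq_of_hasRealCentralCharacter h)⟩
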